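/- Let $(X,d,\mu)$ be a metric measure space, i.e. $(X,d)$ is a metric space and $\mu$ is a Borel measure with $0<\mu(B(x,r))<\infty$ for every open ball $B(x,r)$, $x\in X$, $r\in(0,\infty)$. Definitions. $\mathcal P(X)$ is the set of measurable $p:X\to(0,\infty]$ with $p^-:=\operatorname{ess\,inf}_X p>0$, and $\mathcal P_b(X)$ is the set of those $p\in\mathcal P(X)$ with $p^+:=\operatorname{ess\,sup}_X p<\infty$. For measurable $u:X\to[-\infty,\infty]$ put $\rho_{p(\cdot)}(u)=\int_X\varphi_{p(x)}(|u(x)|)\,d\mu(x)$, where $\varphi_p(t)=t^p$ for $p<\infty$, $\varphi_\infty(t)=0$ for $t\le1$ and $\varphi_\infty(t)=\infty$ for $t>1$. Then $L^{p(\cdot)}(X,\mu)$ is the set of those $u$ with $\rho_{p(\cdot)}(\lambda u)<\infty$ for some $\lambda\in(0,\infty)$, and $\|u\|_{L^{p(\cdot)}}=\inf\{\lambda\in(0,\infty):\rho_{p(\cdot)}(u/\lambda)\le1\}$. For a sequence $g=\{g_k\}_{k\in\mathbb Z}$ of non-negative measurable functions put $$\|g\|_{L^{p(\cdot)}(\ell^{q(\cdot)})}=\Big\|\,x\mapsto\|\{g_k(x)\}_{k\in\mathbb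 Z}\|_{\ell^{q(x)}}\Big\|_{L^{p(\cdot)}},\qquad \|g\|_{\ell^{q(\cdot)}(L^{p(\cdot)})}=\inf\{\lambda\in(0,\infty):\varrho(g/\lambda)\le1\},$$ where $\varrho(g)=\sum_{k\in\mathbb Z}\inf\{\lambda_k\in(0,\infty):\rho_{p(\cdot)}(g_k/\lambda_k^{1/q(\cdot)})\le1\}$, with $\lambda^{1/\infty}=1$ and $\inf\emptyset=\infty$. For $s\in\mathcal P_b(X)$ and a measurable, $\mu$-a.e. finite $u:X\to[-\infty,\infty]$, a vector $s(\cdot)$-gradient of $u$ is a sequence $\{g_k\}_{k\in\mathbb Z}$ of measurable functions $g_k:X\to[0,\infty]$ for which there is a $\mu$-null set $N$ such that $|u(x)-u(y)|\le d(x,y)^{s(x)}g_k(x)+d(x,y)^{s(y)}g_k(y)$ for all $k\in\mathbb Z$ and all $x,y\in X\setminus N$ with $2^{-k-1}\le d(x,y)<2^{-k}$. For $s,p\in\mathcal P_b(X)$, $q\in\mathcal P(X)$ let $\|u\|_{\dot M^{s(\cdot)}_{p(\cdot),q(\cdot)}}$ and $\|u\|_{\dot N^{s(\cdot)}_{p(\cdot),q(\cdot)}}$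 be the infima of $\|g\|_{L^{p(\cdot)}(\ell^{q(\cdot)})}$ and of $\|g\|_{\ell^{q(\cdot)}(L^{p(\cdot)})}$, respectively, over all vector $s(\cdot)$-gradients $g$ of $u$. For $A\in\{M,N\}$, the space $A^{s(\cdot)}_{p(\cdot),q(\cdot)}(X,d,\mu)$ consists of the $u\in L^{p(\cdot)}(X,\mu)$ with $\|u\|_{\dot A^{s(\cdot)}_{p(\cdot),q(\cdot)}}<\infty$, with quasi-norm $\|u\|_{L^{p(\cdot)}}+\|u\|_{\dot A^{s(\cdot)}_{p(\cdot),q(\cdot)}}$. A compact embedding, written $\hookrightarrow\hookrightarrow$, is a bounded inclusion under which every bounded sequence has a subsequence that converges in the larger space. Theorem. Assume that $\sup_{x\in X}\mu(B(x,1))<\infty$ and $\inf_{x\in X}\mu(B(x,r))>0$ for all $r\in(0,1)$. Then the following statements are equivalent: (i) $\mu(X)<\infty$; (ii) for all $p,s\in\mathcal P_b(X)$ and $q\in\mathcal P(X)$ there are both compact embeddings $M^{s(\cdot)}_{p(\cdot),q(\cdot)}(X,d,\mu)\hookrightarrow\hookrightarrow L^{p(\cdot)}(X,\mu)$ and $N^{s(\cdot)}_{p(\cdot),q(\cdot)}(X,d,\mu)\hookrightarrow\hookrightarrow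 L^{p(\cdot)}(X,\mu)$; (iii) there exist $p,s,\beta\in\mathcal P_b(X)$ and $q\in\mathcal P(X)$, satisfying either $s^+<1$ and $q^-<\infty$, or $s^+\le1$ and $q^-=\infty$, such that at least one of the compact embeddings $M^{s(\cdot)}_{p(\cdot),q(\cdot)}(X,d,\mu)\hookrightarrow\hookrightarrow L^{\beta(\cdot)}(X,\mu)$ and $N^{s(\cdot)}_{p(\cdot),q(\cdot)}(X,d,\mu)\hookrightarrow\hookrightarrow L^{\beta(\cdot)}(X,\mu)$ holds. -/

import Mathlib

open MeasureTheory Filter Topology Set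
open scoped ENNReal

noncomputable section

/-! ### Variable exponents -/

/-- `p : X → (0, ∞]` is a variable exponent: measurable, with positive essential infimum. -/
def IsVarExponent {X : Type*} [MeasurableSpace X] (μ : Measure X) (p : X → ℝ≥0∞) : Prop :=
  Measurable p ∧ (∀ x, 0 < p x) ∧ 0 < essInf p μ

/-- Bounded variable exponents, i.e. variable exponents that are essentially bounded. -/
def IsBddVarExponent {X : Type*} [MeasurableSpace X] (μ : Measure X) (p : X → ℝ≥0∞) : Prop :=
  IsVarExponent μ p ∧ essSup p μ < ⊤

/-! ### Variable exponent Lebesgue spaces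

Modulars and quasi-norms are evaluated on `[0, ∞]`-valued functions, and applied to `|u|` when
`u` takes values in the extended reals. -/

/-- `φ_p(t) = t ^ p` for finite `p`; `φ_∞` is `0` on `[0, 1]` and `∞` on `(1, ∞]`. -/
def expPhi (p t : ℝ≥0∞) : ℝ≥0∞ :=
  if p = ⊤ then (if t ≤ 1 then 0 else ⊤) else t ^ p.toReal

/-- The semi-modular `ρ_{p(·)}(f) = ∫ φ_{p(x)}(f(x)) dμ(x)`. -/
def varModular {X : Type*} [MeasurableSpace X] (μ : Measure X) (p f : X → ℝ≥0∞) : ℝ≥0∞ :=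
  ∫⁻ x, expPhi (p x) (f x) ∂μ

/-- The Luxemburg quasi-norm of `L^{p(·)}(X, μ)`; it is `∞` if the infimum is over the empty
set. -/
def varLpNorm {X : Type*} [MeasurableSpace X] (μ : Measure X) (p f : X → ℝ≥0∞) : ℝ≥0∞ :=
  sInf {c : ℝ≥0∞ | 0 < c ∧ c < ⊤ ∧ varModular μ p (fun x => f x / c) ≤ 1}

/-- The space `L^{p(·)}(X, μ)`. -/
def VarLp {X : Type*} [MeasurableSpace X] (μ : Measure X) (p : X → ℝ≥0∞) : Set (X → EReal) :=
  {u | Measurable u ∧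
    ∃ c : ℝ≥0∞, 0 < c ∧ c < ⊤ ∧ varModular μ p (fun x => c * (u x).abs) < ⊤}

/-! ### Mixed Lebesgue sequence spaces -/

/-- The pointwise quantity `‖(f_k)_{k ∈ ℤ}‖_{ℓ^q}`. -/
def seqNorm (q : ℝ≥0∞) (f : ℤ → ℝ≥0∞) : ℝ≥0∞ :=
  if q = ⊤ then ⨆ k, f k else (∑' k, f k ^ q.toReal) ^ (1 / q.toReal)

/-- The quasi-norm of `L^{p(·)}(ℓ^{q(·)})`. -/
def mixedLpSeqNorm {X : Type*} [MeasurableSpace X] (μ : Measure X) (p q : X → ℝ≥0∞)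
    (f : ℤ → X → ℝ≥0∞) : ℝ≥0∞ :=
  varLpNorm μ p (fun x => seqNorm (q x) (fun k => f k x))

/-- The semi-modular of `ℓ^{q(·)}(L^{p(·)})`. For `q(x) = ∞` the exponent `1 / q(x)` is `0`, so
that `c ^ (1 / q(x)) = 1`. -/
def mixedSeqLpModular {X : Type*} [MeasurableSpace X] (μ : Measure X) (p q : X → ℝ≥0∞)
    (f : ℤ → X → ℝ≥0∞) : ℝ≥0∞ :=
  ∑' k, sInf {c : ℝ≥0∞ | 0 < c ∧ c < ⊤ ∧
    varModular μ p (fun x => f k x / c ^ ((q x)⁻¹).toReal) ≤ 1}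

/-- The quasi-norm of `ℓ^{q(·)}(L^{p(·)})`. -/
def mixedSeqLpNorm {X : Type*} [MeasurableSpace X] (μ : Measure X) (p q : X → ℝ≥0∞)
    (f : ℤ → X → ℝ≥0∞) : ℝ≥0∞ :=
  sInf {c : ℝ≥0∞ | 0 < c ∧ c < ⊤ ∧ mixedSeqLpModular μ p q (fun k x => f k x / c) ≤ 1}

/-! ### Hajłasz–Triebel–Lizorkin and Hajłasz–Besov spaces -/

/-- Measurable extended-real-valued functions that are finite almost everywhere. -/
def AEFiniteMeasurable {X : Type*} [MeasurableSpace X] (μ : Measure X) (u : X → EReal) : Prop :=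
  Measurable u ∧ ∀ᵐ x ∂μ, u x ≠ ⊤ ∧ u x ≠ ⊥

/-- The vector `s(·)`-gradients of `u`. The values `s(x) = ∞`, possible only on a null set if `s`
is a bounded exponent, play no role because of the exceptional set `N`. -/
def vectorGradients {X : Type*} [MetricSpace X] [MeasurableSpace X] (μ : Measure X)
    (s : X → ℝ≥0∞) (u : X → EReal) : Set (ℤ → X → ℝ≥0∞) :=
  {g | (∀ k, Measurable (g k)) ∧ ∃ N : Set X, μ N = 0 ∧
    ∀ k : ℤ, ∀ x ∉ N, ∀ y ∉ N, (2 : ℝ) ^ (-k - 1) ≤ dist x y → dist x y < (2 : ℝ) ^ (-k) →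
      (u x - u y).abs ≤
        edist x y ^ (s x).toReal * g k x + edist x y ^ (s y).toReal * g k y}

/-- The quasi-semi-norm of the homogeneous Hajłasz–Triebel–Lizorkin space. -/
def homTLNorm {X : Type*} [MetricSpace X] [MeasurableSpace X] (μ : Measure X)
    (s p q : X → ℝ≥0∞) (u : X → EReal) : ℝ≥0∞ :=
  ⨅ g ∈ vectorGradients μ s u, mixedLpSeqNorm μ p q g

/-- The quasi-semi-norm of the homogeneous Hajłasz–Besov space. -/
def homBesovNorm {X : Type*} [MetricSpace X] [MeasurableSpace X] (μ : Measure X)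
    (s p q : X → ℝ≥0∞) (u : X → EReal) : ℝ≥0∞ :=
  ⨅ g ∈ vectorGradients μ s u, mixedSeqLpNorm μ p q g

/-- The Hajłasz–Triebel–Lizorkin space `M^{s(·)}_{p(·),q(·)}(X, d, μ)`. -/
def HajlaszTL {X : Type*} [MetricSpace X] [MeasurableSpace X] (μ : Measure X)
    (s p q : X → ℝ≥0∞) : Set (X → EReal) :=
  {u | AEFiniteMeasurable μ u ∧ homTLNorm μ s p q u < ⊤} ∩ VarLp μ p

/-- The quasi-norm of `M^{s(·)}_{p(·),q(·)}(X, d, μ)`. -/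
def hajlaszTLNorm {X : Type*} [MetricSpace X] [MeasurableSpace X] (μ : Measure X)
    (s p q : X → ℝ≥0∞) (u : X → EReal) : ℝ≥0∞ :=
  varLpNorm μ p (fun x => (u x).abs) + homTLNorm μ s p q u

/-- The Hajłasz–Besov space `N^{s(·)}_{p(·),q(·)}(X, d, μ)`. -/
def HajlaszBesov {X : Type*} [MetricSpace X] [MeasurableSpace X] (μ : Measure X)
    (s p q : X → ℝ≥0∞) : Set (X → EReal) :=
  {u | AEFiniteMeasurable μ u ∧ homBesovNorm μ s p q u < ⊤} ∩ VarLp μ p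

/-- The quasi-norm of `N^{s(·)}_{p(·),q(·)}(X, d, μ)`. -/
def hajlaszBesovNorm {X : Type*} [MetricSpace X] [MeasurableSpace X] (μ : Measure X)
    (s p q : X → ℝ≥0∞) (u : X → EReal) : ℝ≥0∞ :=
  varLpNorm μ p (fun x => (u x).abs) + homBesovNorm μ s p q u

/-! ### Compact embeddings -/

/-- The function space `A` with quasi-norm `normA` is compactly embedded into `L^{β(·)}(X, μ)`:
`A` is contained in `L^{β(·)}`, the inclusion is bounded, and every bounded sequence of `A` has a
subsequence that converges in `L^{β(·)}`. -/
def IsCompactlyEmbeddedInVarLp {X : Type*} [MeasurableSpace X] (μ : Measure X)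
    (A : Set (X → EReal)) (normA : (X → EReal) → ℝ≥0∞) (β : X → ℝ≥0∞) : Prop :=
  A ⊆ VarLp μ β ∧
  (∃ C : ℝ≥0∞, C < ⊤ ∧ ∀ u ∈ A, varLpNorm μ β (fun x => (u x).abs) ≤ C * normA u) ∧
  ∀ u : ℕ → X → EReal, (∀ n, u n ∈ A) → (∃ C : ℝ≥0∞, C < ⊤ ∧ ∀ n, normA (u n) ≤ C) →
    ∃ v ∈ VarLp μ β, ∃ m : ℕ → ℕ, StrictMono m ∧
      Tendsto (fun n => varLpNorm μ β (fun x => (u (m n) x - v x).abs)) atTop (𝓝 0)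

/-- The compact embedding `M^{s(·)}_{p(·),q(·)} ↪↪ L^{β(·)}`. -/
def TLCompactEmbedding {X : Type*} [MetricSpace X] [MeasurableSpace X] (μ : Measure X)
    (s p q β : X → ℝ≥0∞) : Prop :=
  IsCompactlyEmbeddedInVarLp μ (HajlaszTL μ s p q) (hajlaszTLNorm μ s p q) β

/-- The compact embedding `N^{s(·)}_{p(·),q(·)} ↪↪ L^{β(·)}`. -/
def BesovCompactEmbedding {X : Type*} [MetricSpace X] [MeasurableSpace X] (μ : Measure X)
    (s p q β : X → ℝ≥0∞) : Prop :=
  IsCompactlyEmbeddedInVarLp μ (HajlaszBesov μ s p q) (hajlaszBesovNorm μ s p q) β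

end

/-! ### The functions `φ_p` -/

/-! If `μ` is finite, the lower bound on ball measures makes `X` totally bounded, so `X` splits into
finitely many measurable cells of diameter below `2^(-K)`. A bound in either space yields gradients
with `ρ(g_k / λ) ≤ 1` for every `k`; nothing more is needed from the mixed norms. If `s ≥ 2σ` and `τ
= 2^(-σ)`, the oscillation of `u` at scale `2^(-K)` is controlled by `λ τ^K` times `f_K = sup_j
τ^(K+j) g_(K+j) / λ` (`edist_le_of_vectorGradient`), and `ρ(f_K)` decays geometrically in `K`. Hence
on each cell `u` is almost constant (`exists_const_approx`). The constants are bounded and countable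
in number, so along a subsequence they all converge, and the resulting step functions converge a.e.
to the limit (`exists_subseq_tendsto_varLpNorm`). Errors are estimated pointwise and collected into
suprema, since the modular of a supremum is at most the sum of the modulars (`varModular_iSup_le`);
this avoids any triangle inequality for the quasi-norm.

If `μ` is infinite while unit balls have bounded measure, there is an infinite `1`-separated
sequence. Bumps at its points have gradients `4 · 2^(-ε|k|)` on unit balls and are uniformly bounded
in both spaces (`exists_homNorm_bump_le`): the gap `ε ≤ s ≤ 1 - ε` with `ε > 0` gives summability in
`k`, and `ε = 0` suffices when `q = ∞`. Distinct bumps differ by at least `1/2` on a ball of radius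
`1/8`, whose measure is bounded below, so no subsequence converges
(`not_isCompactlyEmbeddedInVarLp`). -/

lemma expPhi_mono (p : ℝ≥0∞) : Monotone (expPhi p) := by
  intro a b hab
  unfold expPhi
  split_ifs with h1 h2 h3 h3
  · exact le_rfl
  · exact zero_le
  · exact absurd (hab.trans h3) h2
  · exact le_rfl
  · exact ENNReal.rpow_le_rpow hab ENNReal.toReal_nonneg

/-- Replacing `p` by its uniform lower bound `κ` makes the factor independent of the point, so that
it can leave the integral. -/
lemma expPhi_mul_le {p : ℝ≥0∞} {κ : ℝ} (hκ : 0 < κ) (hp : ENNReal.ofReal κ ≤ p) {a : ℝ≥0∞}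
    (ha : a ≤ 1) (t : ℝ≥0∞) : expPhi p (a * t) ≤ a ^ κ * expPhi p t := by
  unfold expPhi
  split_ifs with h1 h2 h3 h3
  · simp
  · exact zero_le
  · exact absurd (mul_le_one' ha h3) h2
  · rw [ENNReal.mul_top]
    -- If `a ^ κ` vanished, so would `a * t`, which exceeds `1` in this branch.
    · rintro h
      rcases (ENNReal.rpow_eq_zero_iff).1 h with h | h
      · apply h2; simp [h.1]
      · linarith [h.2]
  · rw [ENNReal.mul_rpow_of_nonneg _ _ ENNReal.toReal_nonneg]
    gcongr 1
    exact ENNReal.rpow_le_rpow_of_exponent_ge ha ((ENNReal.ofReal_le_iff_le_toReal h1).1 hp)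

lemma expPhi_zero {p : ℝ≥0∞} (hp : 0 < p) : expPhi p 0 = 0 := by
  unfold expPhi
  split_ifs with h1 h2
  · rfl
  · simp at h2
  · exact ENNReal.zero_rpow_of_pos (ENNReal.toReal_pos hp.ne' h1)

lemma expPhi_le_one (p : ℝ≥0∞) {t : ℝ≥0∞} (ht : t ≤ 1) : expPhi p t ≤ 1 := by
  unfold expPhi
  split_ifs
  · exact zero_le_one
  · exact ENNReal.rpow_le_one ht ENNReal.toReal_nonneg

lemma rpow_le_expPhi {p : ℝ≥0∞} {κ : ℝ} (hp : ENNReal.ofReal κ ≤ p) {t b : ℝ≥0∞}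
    (ht : 1 < t) (htb : t ≤ b) : t ^ κ ≤ expPhi p b := by
  refine le_trans ?_ (expPhi_mono p htb)
  unfold expPhi
  split_ifs with h1 h2
  · exact absurd h2 ht.not_ge
  · exact le_top
  · exact ENNReal.rpow_le_rpow_of_exponent_le ht.le ((ENNReal.ofReal_le_iff_le_toReal h1).1 hp)

/-- For finite `p` the power map commutes with suprema; for `p = ∞` either all arguments are at most
`1` or one term of the sum is already infinite. -/
lemma expPhi_iSup_le {ι : Type*} (p : ℝ≥0∞) (hp : 0 < p) (f : ι → ℝ≥0∞) :
    expPhi p (⨆ i, f i) ≤ ∑' i, expPhi p (f i) := by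
  by_cases h : p = ⊤
  · by_cases h1 : ∀ i, f i ≤ 1
    · simp [expPhi, h, h1]
    · push Not at h1
      obtain ⟨i, hi⟩ := h1
      have : expPhi p (f i) = ⊤ := by simp [expPhi, h, hi]
      exact le_trans (le_top.trans_eq this.symm) (ENNReal.le_tsum i)
  · have hp0 : 0 < p.toReal := ENNReal.toReal_pos hp.ne' h
    simp only [expPhi, h, if_false]
    rw [← ENNReal.orderIsoRpow_apply p.toReal hp0, OrderIso.map_iSup]
    exact iSup_le fun i => ENNReal.le_tsum (f := fun i => f i ^ p.toReal) i

section Modular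

variable {X : Type*} [MeasurableSpace X] {μ : Measure X} {p : X → ℝ≥0∞}

lemma measurable_expPhi {f : X → ℝ≥0∞} (hp : Measurable p) (hf : Measurable f) :
    Measurable fun x => expPhi (p x) (f x) := by
  unfold expPhi
  refine Measurable.ite (hp (measurableSet_singleton _)) ?_ (hf.pow hp.ennreal_toReal)
  exact Measurable.ite (measurableSet_le hf measurable_const) measurable_const measurable_const

/-! ### Essential bounds -/

lemma exists_ofReal_le_ae {f : X → ℝ≥0∞} (hf : 0 < essInf f μ) :
    ∃ κ : ℝ, 0 < κ ∧ ∀ᵐ x ∂μ, ENNReal.ofReal κ ≤ f x := by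
  -- The essential infimum may be `∞`, hence a finite number strictly below it.
  obtain ⟨r, h0, h1⟩ := ENNReal.lt_iff_exists_nnreal_btwn.1 hf
  refine ⟨r, by exact_mod_cast h0, ?_⟩
  filter_upwards [ae_essInf_le (f := f) (μ := μ)] with x hx
  rw [ENNReal.ofReal_coe_nnreal]
  exact h1.le.trans hx

lemma ae_lt_top_of_essSup {f : X → ℝ≥0∞} (hf : essSup f μ < ⊤) : ∀ᵐ x ∂μ, f x < ⊤ := by
  filter_upwards [ae_le_essSup (f := f) (μ := μ)] with x hx using hx.trans_lt hf

/-! ### The semi-modular -/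

lemma varModular_mono_ae {f g : X → ℝ≥0∞} (h : ∀ᵐ x ∂μ, f x ≤ g x) :
    varModular μ p f ≤ varModular μ p g :=
  lintegral_mono_ae (h.mono fun x hx => expPhi_mono (p x) hx)

lemma varModular_congr_ae {f g : X → ℝ≥0∞} (h : ∀ᵐ x ∂μ, f x = g x) :
    varModular μ p f = varModular μ p g :=
  le_antisymm (varModular_mono_ae (h.mono fun _ hx => hx.le))
    (varModular_mono_ae (h.mono fun _ hx => hx.ge))

lemma varModular_const_mul_le {κ : ℝ} (hκ : 0 < κ) (hp : ∀ᵐ x ∂μ, ENNReal.ofReal κ ≤ p x)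
    {a : ℝ≥0∞} (ha : a ≤ 1) (f : X → ℝ≥0∞) :
    varModular μ p (fun x => a * f x) ≤ a ^ κ * varModular μ p f := by
  unfold varModular
  rw [← lintegral_const_mul' _ _
    (ENNReal.rpow_ne_top_of_nonneg hκ.le (ha.trans_lt ENNReal.one_lt_top).ne)]
  exact lintegral_mono_ae (hp.mono fun x hx => expPhi_mul_le hκ hx ha _)

lemma varModular_iSup_le {ι : Type*} [Countable ι] (hpm : Measurable p) (hp : ∀ x, 0 < p x)
    {f : ι → X → ℝ≥0∞} (hf : ∀ i, Measurable (f i)) :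
    varModular μ p (fun x => ⨆ i, f i x) ≤ ∑' i, varModular μ p (f i) := by
  unfold varModular
  rw [← lintegral_tsum fun i => (measurable_expPhi hpm (hf i)).aemeasurable]
  exact lintegral_mono fun x => expPhi_iSup_le (p x) (hp x) _

/-- A Chebyshev inequality for the semi-modular. -/
lemma rpow_mul_measure_le_varModular {κ : ℝ} (hp : ∀ᵐ x ∂μ, ENNReal.ofReal κ ≤ p x)
    {t : ℝ≥0∞} (ht : 1 < t) {f : X → ℝ≥0∞} {S : Set X} (hS : MeasurableSet S)
    (hf : ∀ x ∈ S, t ≤ f x) : t ^ κ * μ S ≤ varModular μ p f := by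
  rw [← lintegral_indicator_const hS]
  refine lintegral_mono_ae (hp.mono fun x hx => ?_)
  by_cases hxS : x ∈ S
  · simpa [hxS] using rpow_le_expPhi hx ht (hf x hxS)
  · simp [hxS]

lemma ae_lt_top_of_varModular {κ : ℝ} (hκ : 0 < κ) (hp : ∀ᵐ x ∂μ, ENNReal.ofReal κ ≤ p x)
    {f : X → ℝ≥0∞} (hfm : Measurable f) (hf : varModular μ p f < ⊤) : ∀ᵐ x ∂μ, f x < ⊤ := by
  have hS : MeasurableSet {x | f x = ⊤} := hfm (measurableSet_singleton _)
  have h := rpow_mul_measure_le_varModular hp ENNReal.one_lt_top hS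
    (f := f) (fun x hx => (show f x = ⊤ from hx).ge)
  rw [ENNReal.top_rpow_of_pos hκ] at h
  have h0 : μ {x | f x = ⊤} = 0 := by
    by_contra h0
    rw [ENNReal.top_mul h0] at h
    exact (h.trans_lt hf).ne rfl
  filter_upwards [measure_eq_zero_iff_ae_notMem.1 h0] with x hx
  exact lt_top_iff_ne_top.2 hx

/-- For large arguments `t ^ κ * e` exceeds any prescribed finite bound. -/
lemma exists_lt_rpow_mul {κ : ℝ} (hκ : 0 < κ) {e M : ℝ≥0∞} (he : 0 < e) (hM : M < ⊤) :
    ∃ t : ℝ≥0∞, 1 < t ∧ t < ⊤ ∧ M < t ^ κ * e := by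
  have h1 : Tendsto (fun n : ℕ => ((n : ℝ≥0∞) ^ κ) * e) atTop (𝓝 (⊤ * e)) :=
    ENNReal.Tendsto.mul_const
      ((ENNReal.tendsto_rpow_at_top hκ).comp ENNReal.tendsto_nat_nhds_top) (Or.inl ENNReal.top_ne_zero)
  rw [ENNReal.top_mul he.ne'] at h1
  obtain ⟨n, hn, hn1⟩ := ((h1.eventually (lt_mem_nhds hM)).and (eventually_gt_atTop 1)).exists
  exact ⟨n, by exact_mod_cast hn1, ENNReal.natCast_lt_top n, hn⟩

lemma exists_rpow_mul_le_one {κ : ℝ} (hκ : 0 < κ) {M : ℝ≥0∞} (hM : M < ⊤) :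
    ∃ a : ℝ≥0∞, 0 < a ∧ a < 1 ∧ a ^ κ * M ≤ 1 := by
  obtain ⟨t, ht1, ht, h⟩ := exists_lt_rpow_mul hκ one_pos hM
  refine ⟨t⁻¹, ENNReal.inv_pos.2 ht.ne, ENNReal.inv_lt_one.2 ht1, ?_⟩
  rw [ENNReal.inv_rpow, mul_comm, ← div_eq_mul_inv]
  exact ENNReal.div_le_of_le_mul (by simpa using h.le)

/-! ### The Luxemburg quasi-norm -/

lemma varModular_div_le_one_of_varLpNorm_lt {f : X → ℝ≥0∞} {c : ℝ≥0∞} (h : varLpNorm μ p f < c) :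
    varModular μ p (fun x => f x / c) ≤ 1 := by
  obtain ⟨b, ⟨_, _, hb⟩, hbc⟩ := sInf_lt_iff.1 h
  refine le_trans (varModular_mono_ae (ae_of_all _ fun x => ?_)) hb
  exact ENNReal.div_le_div_left hbc.le _

lemma varLpNorm_le {f : X → ℝ≥0∞} {c : ℝ≥0∞} (h0 : 0 < c) (h1 : c < ⊤)
    (h : varModular μ p (fun x => f x / c) ≤ 1) : varLpNorm μ p f ≤ c :=
  sInf_le ⟨h0, h1, h⟩

/-- Convergence to zero in the Luxemburg quasi-norm from geometric bounds. -/
lemma tendsto_varLpNorm_zero {κ : ℝ} (hκ : 0 < κ) (hp : ∀ᵐ x ∂μ, ENNReal.ofReal κ ≤ p x)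
    {τ Λ M : ℝ≥0∞} (hτ : τ < 1) (hΛ : Λ < ⊤) (hM : M < ⊤) (f : ℕ → X → ℝ≥0∞)
    (h : ∀ K : ℕ, ∀ᶠ n in atTop, ∃ S : X → ℝ≥0∞, varModular μ p S ≤ M ∧
      ∀ᵐ x ∂μ, f n x ≤ Λ * τ ^ K * S x) :
    Tendsto (fun n => varLpNorm μ p (f n)) atTop (𝓝 0) := by
  obtain ⟨a, ha0, ha1, ha⟩ := exists_rpow_mul_le_one hκ hM
  rw [ENNReal.tendsto_nhds_zero]
  intro ε hε
  wlog hεt : ε < ⊤ generalizing ε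
  · filter_upwards [this 1 one_pos ENNReal.one_lt_top] with n hn
    rw [not_lt_top_iff.1 hεt]
    exact le_top
  have h1 : Tendsto (fun K : ℕ => Λ * τ ^ K) atTop (𝓝 (Λ * 0)) :=
    ENNReal.Tendsto.const_mul (ENNReal.tendsto_pow_atTop_nhds_zero_of_lt_one hτ) (Or.inr hΛ.ne)
  rw [mul_zero] at h1
  obtain ⟨K, hK⟩ := ((ENNReal.tendsto_nhds_zero.1 h1) (a * ε) (ENNReal.mul_pos ha0.ne' hε.ne')).exists
  filter_upwards [h K] with n hn
  obtain ⟨S, hSM, hS⟩ := hn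
  refine varLpNorm_le hε hεt (le_trans (varModular_mono_ae (g := fun x => a * S x) ?_)
    ((varModular_const_mul_le hκ hp ha1.le S).trans (le_trans (by gcongr) ha)))
  filter_upwards [hS] with x hx
  refine ENNReal.div_le_of_le_mul (hx.trans ?_)
  calc Λ * τ ^ K * S x ≤ a * ε * S x := by gcongr
    _ = a * S x * ε := by ring

end Modular

/-! ### Separated sequences and finite partitions -/

lemma exists_separated_seq {X : Type*} [MetricSpace X] {r : ℝ}
    (h : ∀ t : Finset X, ∃ y, ∀ x ∈ t, r ≤ dist x y) :
    ∃ f : ℕ → X, ∀ m n, m ≠ n → r ≤ dist (f m) (f n) := by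
  obtain ⟨f, -, hf⟩ := exists_seq_of_forall_finset_exists (fun _ : X => True)
    (fun x y => r ≤ dist x y) (fun t _ => (h t).imp fun y hy => ⟨trivial, hy⟩)
  refine ⟨f, fun m n hmn => ?_⟩
  rcases hmn.lt_or_gt with h | h
  · exact hf m n h
  · rw [dist_comm]; exact hf n m h

/-- Otherwise there is an infinite `r`-separated sequence; its balls of radius `r / 2` are disjoint
with measures bounded below, so `μ` would be infinite. -/
lemma exists_finset_cover {X : Type*} [MetricSpace X] [MeasurableSpace X] [BorelSpace X]
    (μ : Measure X) (hfin : μ univ < ⊤) {r : ℝ}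
    (hinf : 0 < ⨅ x : X, μ (Metric.ball x (r / 2))) :
    ∃ t : Finset X, ∀ y, ∃ x ∈ t, dist x y < r := by
  by_contra hcon
  push Not at hcon
  obtain ⟨f, hf⟩ := exists_separated_seq hcon
  have hdisj : Pairwise (Function.onFun Disjoint fun n => Metric.ball (f n) (r / 2)) := by
    intro m n hmn
    exact Metric.ball_disjoint_ball (by linarith [hf m n hmn])
  have h1 := measure_iUnion (μ := μ) hdisj fun n => measurableSet_ball
  have h2 : (⊤ : ℝ≥0∞) ≤ ∑' n, μ (Metric.ball (f n) (r / 2)) := by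
    rw [← ENNReal.tsum_const_eq_top_of_ne_zero (α := ℕ) hinf.ne']
    exact ENNReal.tsum_le_tsum fun n => iInf_le _ (f n)
  rw [← h1] at h2
  exact absurd (h2.trans (measure_mono (subset_univ _))) hfin.not_ge

lemma exists_measurable_index {X : Type*} [MetricSpace X] [MeasurableSpace X] [BorelSpace X]
    (μ : Measure X) (hfin : μ univ < ⊤)
    (hinf : ∀ r : ℝ, 0 < r → r < 1 → 0 < ⨅ x : X, μ (Metric.ball x r)) {r : ℝ} (hr : 0 < r)
    (hr1 : r ≤ 1) :
    ∃ (m : ℕ) (idx : X → ℕ), Measurable idx ∧ (∀ x, idx x < m) ∧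
      ∀ x y, idx x = idx y → dist x y < r := by
  classical
  rcases isEmpty_or_nonempty X with hX | hX
  · exact ⟨0, fun _ => 0, measurable_const, fun x => hX.elim x, fun x => hX.elim x⟩
  obtain ⟨t, ht⟩ := exists_finset_cover μ hfin (r := r / 2)
    (hinf (r / 2 / 2) (by positivity) (by linarith))
  let l := t.toList
  -- Each point goes to the first centre within `r / 2`. The default value of `getD` is harmless: a
  -- valid index below `l.length` always exists, so the search stops before it.
  let P : X → ℕ → Prop := fun x n => dist (l.getD n (Classical.arbitrary X)) x < r / 2
  have hP' : ∀ x, ∃ n < l.length, P x n := by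
    intro x
    obtain ⟨y, hy, hyx⟩ := ht x
    obtain ⟨n, hn, hny⟩ := List.getElem_of_mem (Finset.mem_toList.2 hy)
    refine ⟨n, hn, ?_⟩
    simp only [P]
    rw [List.getD_eq_getElem _ _ hn, hny]
    exact hyx
  have hP : ∀ x, ∃ n, P x n := fun x => (hP' x).imp fun n hn => hn.2
  refine ⟨l.length, fun x => Nat.find (hP x), measurable_find hP fun k => ?_, fun x => ?_,
    fun x y hxy => ?_⟩
  · exact (isOpen_lt (continuous_const.dist continuous_id) continuous_const).measurableSet
  · obtain ⟨n, hn, hn'⟩ := hP' x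
    exact (Nat.find_min' (hP x) hn').trans_lt hn
  · have h1 : P x (Nat.find (hP x)) := Nat.find_spec (hP x)
    have h2 : P y (Nat.find (hP y)) := Nat.find_spec (hP y)
    have hxy' : Nat.find (hP x) = Nat.find (hP y) := hxy
    rw [← hxy'] at h2
    simp only [P] at h1 h2
    have := dist_triangle_left x y (l.getD (Nat.find (hP x)) (Classical.arbitrary X))
    linarith

/-! ### Approximation by constants on a set of small diameter -/

/-- By Chebyshev, `w` and `h` are each large on less than half of `A`, so some point of `A` has both
small. The constant is `w y` with `h y` within `η` of the infimum of `h`, whence `h y ≤ h x + η` for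
every other `x`. That `T` is chosen before `w` and `h` is what later gives compactness of the
constants. -/
lemma exists_const_approx {X : Type*} [MeasurableSpace X] {μ : Measure X} {p : X → ℝ≥0∞} {κ : ℝ}
    (hκ : 0 < κ) (hp : ∀ᵐ x ∂μ, ENNReal.ofReal κ ≤ p x) {A : Set X}
    {lam M η : ℝ≥0∞} (hl0 : 0 < lam) (hlam : lam < ⊤) (hM : M < ⊤) (hη0 : 0 < η) (hη : η < ⊤) :
    ∃ T : ℝ, ∀ (w : X → ℝ) (h : X → ℝ≥0∞) (N : Set X), Measurable w → Measurable h →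
      varModular μ p (fun x => ‖w x‖ₑ / lam) ≤ M → varModular μ p (fun x => h x / lam) ≤ M →
      μ N = 0 → (∀ x ∈ A \ N, ∀ y ∈ A \ N, edist (w x) (w y) ≤ h x + h y) →
      ∃ c ∈ Icc (-T) T, ∀ᵐ x ∂μ, x ∈ A → edist (w x) c ≤ 2 * h x + η := by
  by_cases hA0 : μ A = 0
  · refine ⟨0, fun w h N _ _ _ _ _ _ => ⟨0, by simp, ?_⟩⟩
    filter_upwards [measure_eq_zero_iff_ae_notMem.1 hA0] with x hx hxA using absurd hxA hx
  obtain ⟨t, ht1, ht, htA⟩ := exists_lt_rpow_mul hκ (ENNReal.half_pos hA0) hM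
  have htop : 3 * (t * lam) + η < ⊤ :=
    ENNReal.add_lt_top.2 ⟨ENNReal.mul_lt_top (by simp) (ENNReal.mul_lt_top ht hlam), hη⟩
  refine ⟨(3 * (t * lam) + η).toReal, ?_⟩
  intro w h N hw hh hwM hhM hN hwh
  have key : ∀ f : X → ℝ≥0∞, Measurable f → varModular μ p (fun x => f x / lam) ≤ M →
      μ {x | t * lam ≤ f x} < μ A / 2 := by
    intro f hf hfM
    have h1 := rpow_mul_measure_le_varModular hp ht1 (f := fun x => f x / lam)
      (measurableSet_le measurable_const hf : MeasurableSet {x | t * lam ≤ f x})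
      (fun x hx => (ENNReal.le_div_iff_mul_le (Or.inl hl0.ne') (Or.inl hlam.ne)).2 hx)
    by_contra hcon
    push Not at hcon
    exact absurd ((mul_le_mul_right hcon (t ^ κ)).trans (h1.trans hfM)) htA.not_ge
  have h1 := key _ hw.enorm hwM
  have h2 := key _ hh hhM
  have hex : ∃ x ∈ A \ N, ‖w x‖ₑ < t * lam ∧ h x < t * lam := by
    by_contra hcon
    push Not at hcon
    have hsub : A ⊆ N ∪ ({x | t * lam ≤ ‖w x‖ₑ} ∪ {x | t * lam ≤ h x}) := by
      intro x hx
      by_cases hxN : x ∈ N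
      · exact Or.inl hxN
      · by_cases hxw : t * lam ≤ ‖w x‖ₑ
        · exact Or.inr (Or.inl hxw)
        · exact Or.inr (Or.inr (hcon x ⟨hx, hxN⟩ (not_le.1 hxw)))
    have := calc μ A ≤ μ N + (μ {x | t * lam ≤ ‖w x‖ₑ} + μ {x | t * lam ≤ h x}) :=
          (measure_mono hsub).trans ((measure_union_le _ _).trans
            (by gcongr; exact measure_union_le _ _))
      _ < μ A / 2 + μ A / 2 := by rw [hN, zero_add]; exact ENNReal.add_lt_add h1 h2
      _ = μ A := ENNReal.add_halves _
    exact this.false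
  obtain ⟨x0, hx0, hw0, hh0⟩ := hex
  -- The point `x0` makes the infimum finite, so adding `η` is a strict increase; below, it also
  -- bounds `w y`.
  have hinf : (⨅ x ∈ A \ N, h x) < (⨅ x ∈ A \ N, h x) + η :=
    ENNReal.lt_add_right ((biInf_le _ hx0).trans_lt (hh0.trans_le
      (ENNReal.mul_lt_top ht hlam).le)).ne hη0.ne'
  obtain ⟨y, hy, hyη⟩ : ∃ y ∈ A \ N, h y < (⨅ x ∈ A \ N, h x) + η := by
    obtain ⟨y, hy⟩ := iInf_lt_iff.1 hinf
    obtain ⟨hyA, hy⟩ := iInf_lt_iff.1 hy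
    exact ⟨y, hyA, hy⟩
  have hyx : ∀ x ∈ A \ N, h y ≤ h x + η := fun x hx =>
    hyη.le.trans (by gcongr; exact biInf_le _ hx)
  have hc : ∀ x ∈ A \ N, edist (w x) (w y) ≤ 2 * h x + η := fun x hx =>
    (hwh x hx y hy).trans (by rw [two_mul, add_assoc]; gcongr; exact hyx x hx)
  refine ⟨w y, ?_, ?_⟩
  · have h3 : ‖w y‖ₑ ≤ 3 * (t * lam) + η := by
      calc ‖w y‖ₑ = edist (w y) 0 := (edist_zero_right _).symm
        _ ≤ edist (w y) (w x0) + edist (w x0) 0 := edist_triangle _ _ _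
        _ ≤ (2 * h x0 + η) + ‖w x0‖ₑ := by
          rw [edist_comm, edist_zero_right]; gcongr; exact hc x0 hx0
        _ ≤ (2 * (t * lam) + η) + t * lam := by gcongr
        _ = 3 * (t * lam) + η := by ring
    have h4 : |w y| ≤ (3 * (t * lam) + η).toReal := by
      have := ENNReal.toReal_mono htop.ne h3
      simpa using this
    exact abs_le.1 h4
  · filter_upwards [measure_eq_zero_iff_ae_notMem.1 hN] with x hx hxA using hc x ⟨hxA, hx⟩

/-! ### Extraction of a subsequence converging in `L^{p(·)}` -/

lemma varModular_sup_le {X : Type*} [MeasurableSpace X] {μ : Measure X} {p : X → ℝ≥0∞}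
    (hpm : Measurable p) (hp : ∀ x, 0 < p x) {f g : X → ℝ≥0∞} (hf : Measurable f)
    (hg : Measurable g) :
    varModular μ p (fun x => f x ⊔ g x) ≤ varModular μ p f + varModular μ p g := by
  have := varModular_iSup_le (μ := μ) (ι := Bool) hpm hp (f := fun b => bif b then f else g)
    (by rintro (_ | _) <;> assumption)
  simpa [iSup_bool_eq, tsum_fintype, Fintype.sum_bool] using this

/-- Simultaneous extraction: a family of bounded real sequences has a common subsequence along
which all of them converge. -/
lemma exists_common_subseq {ι : Type*} [Countable ι] (T : ι → ℝ) (c : ℕ → ι → ℝ)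
    (hc : ∀ n i, c n i ∈ Icc (-T i) (T i)) :
    ∃ (a : ι → ℝ) (φ : ℕ → ℕ), StrictMono φ ∧
      ∀ i, Tendsto (fun n => c (φ n) i) atTop (𝓝 (a i)) := by
  obtain ⟨a, -, φ, hφ, h⟩ := (isCompact_univ_pi fun i => isCompact_Icc (a := -T i) (b := T i)).tendsto_subseq
    (x := c) (fun n i _ => hc n i)
  exact ⟨a, φ, hφ, fun i => tendsto_pi_nhds.1 h i⟩

/-- A compactness criterion in variable exponent Lebesgue spaces over a finite measure. -/
theorem exists_subseq_tendsto_varLpNorm {X : Type*} [MetricSpace X] [MeasurableSpace X]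
    [BorelSpace X] {μ : Measure X} (hfin : μ univ < ⊤)
    (hinf : ∀ r : ℝ, 0 < r → r < 1 → 0 < ⨅ x : X, μ (Metric.ball x r)) {p : X → ℝ≥0∞}
    (hpm : Measurable p) (hp0 : ∀ x, 0 < p x) {κ : ℝ} (hκ : 0 < κ)
    (hp : ∀ᵐ x ∂μ, ENNReal.ofReal κ ≤ p x) {τ θ lam M : ℝ≥0∞} (hτ0 : 0 < τ) (hτ : τ < 1)
    (hθ : θ < 1) (hl0 : 0 < lam) (hlam : lam < ⊤) (hM : M < ⊤) (w : ℕ → X → ℝ)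
    (hw : ∀ n, Measurable (w n)) (hwM : ∀ n, varModular μ p (fun x => ‖w n x‖ₑ / lam) ≤ M)
    (f : ℕ → ℕ → X → ℝ≥0∞) (hf : ∀ n K, Measurable (f n K))
    (hfM : ∀ n K, varModular μ p (f n K) ≤ M * θ ^ K) (N : ℕ → Set X) (hN : ∀ n, μ (N n) = 0)
    (hwf : ∀ n K, ∀ x ∉ N n, ∀ y ∉ N n, dist x y < (1 / 2) ^ K →
      edist (w n x) (w n y) ≤ lam * τ ^ K * f n K x + lam * τ ^ K * f n K y) :
    ∃ (v : X → ℝ) (φ : ℕ → ℕ), Measurable v ∧ StrictMono φ ∧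
      (∃ c : ℝ≥0∞, 0 < c ∧ c < ⊤ ∧ varModular μ p (fun x => c * ‖v x‖ₑ) < ⊤) ∧
      Tendsto (fun n => varLpNorm μ p (fun x => edist (w (φ n) x) (v x))) atTop (𝓝 0) := by
  have hfM' : ∀ n K, varModular μ p (f n K) ≤ M := fun n K =>
    (hfM n K).trans (mul_le_of_le_one_right' (pow_le_one₀ zero_le hθ.le))
  have hητ0 : ∀ K, 0 < lam * τ ^ K := fun K => ENNReal.mul_pos hl0.ne' (ENNReal.pow_pos hτ0 K).ne'
  have hητ : ∀ K, lam * τ ^ K < ⊤ := fun K =>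
    ENNReal.mul_lt_top hlam (ENNReal.pow_lt_top (hτ.trans ENNReal.one_lt_top))
  have hτK : ∀ K, τ ^ K ≤ 1 := fun K => pow_le_one₀ zero_le hτ.le
  choose m idx hidx hidxm hidxd using fun K : ℕ =>
    exists_measurable_index μ hfin hinf (r := (1 / 2 : ℝ) ^ K) (by positivity)
      (pow_le_one₀ (by norm_num) (by norm_num))
  choose T hT using fun i : ℕ × ℕ =>
    exists_const_approx hκ hp (A := {x | idx i.1 x = i.2}) hl0 hlam hM (hητ0 i.1) (hητ i.1)
  have hcex : ∀ n : ℕ, ∀ i : ℕ × ℕ, ∃ c ∈ Icc (-T i) (T i), ∀ᵐ x ∂μ, x ∈ {x | idx i.1 x = i.2} →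
      edist (w n x) c ≤ 2 * (lam * τ ^ i.1 * f n i.1 x) + lam * τ ^ i.1 := by
    rintro n ⟨K, i⟩
    refine hT (K, i) (w n) (fun x => lam * τ ^ K * f n K x) (N n) (hw n)
      ((hf n K).const_mul _) (hwM n) ?_ (hN n) ?_
    · refine le_trans (varModular_mono_ae (ae_of_all _ fun x => ?_)) (hfM' n K)
      refine ENNReal.div_le_of_le_mul ?_
      calc lam * τ ^ K * f n K x ≤ lam * 1 * f n K x := by gcongr; exact hτK K
        _ = f n K x * lam := by ring
    · rintro x ⟨hx, hxN⟩ y ⟨hy, hyN⟩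
      exact hwf n K x hxN y hyN (hidxd K x y (Eq.trans hx (Eq.symm hy)))
  choose c hcT hc using hcex
  have hc' : ∀ n K, ∀ᵐ x ∂μ, edist (w n x) (c n (K, idx K x)) ≤ lam * τ ^ K * (2 * f n K x + 1) := by
    intro n K
    filter_upwards [ae_all_iff.2 fun i => hc n (K, i)] with x hx
    refine (hx (idx K x) rfl).trans_eq ?_
    ring
  obtain ⟨a, φ, hφ, ha⟩ := exists_common_subseq T c hcT
  let V : ℕ → X → ℝ := fun K x => a (K, idx K x)
  have hev : ∀ K, ∀ᶠ n in atTop, ∀ i < m K, edist (c (φ n) (K, i)) (a (K, i)) ≤ lam * τ ^ K := by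
    intro K
    have : ∀ i ∈ Finset.range (m K),
        ∀ᶠ n in atTop, edist (c (φ n) (K, i)) (a (K, i)) ≤ lam * τ ^ K := by
      intro i _
      exact ((EMetric.tendsto_nhds.1 (ha (K, i))) _ (hητ0 K)).mono fun n hn => hn.le
    filter_upwards [(Finset.eventually_all (Finset.range (m K))).2 this] with n hn i hi
    exact hn i (Finset.mem_range.2 hi)
  choose n₀ hn₀ using fun K => eventually_atTop.1 (hev K)
  have hwV : ∀ K n, n₀ K ≤ n → ∀ᵐ x ∂μ,
      edist (w (φ n) x) (V K x) ≤ lam * τ ^ K * (2 * f (φ n) K x + 2) := by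
    intro K n hn
    filter_upwards [hc' (φ n) K] with x hx
    calc edist (w (φ n) x) (V K x)
        ≤ edist (w (φ n) x) (c (φ n) (K, idx K x)) + edist (c (φ n) (K, idx K x)) (V K x) :=
          edist_triangle _ _ _
      _ ≤ lam * τ ^ K * (2 * f (φ n) K x + 1) + lam * τ ^ K :=
          add_le_add hx (hn₀ K n hn _ (hidxm K x))
      _ = lam * τ ^ K * (2 * f (φ n) K x + 2) := by ring
  -- One index late enough for both levels `K` and `K + 1`, so that `V K` and `V (K + 1)` are
  -- compared through the same function `w (k K)`.
  let k : ℕ → ℕ := fun K => φ (max (n₀ K) (n₀ (K + 1)))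
  -- The factor `θ ^ K` in the modular bounds makes the suprema over all levels have finite modular;
  -- they dominate every telescoping step at once.
  let F₁ : X → ℝ≥0∞ := fun x => ⨆ K, f (k K) K x
  let F₂ : X → ℝ≥0∞ := fun x => ⨆ K, f (k K) (K + 1) x
  have hsum : M * (1 - θ)⁻¹ < ⊤ := ENNReal.mul_lt_top hM (by simpa using hθ)
  have hF₁ : varModular μ p F₁ ≤ M * (1 - θ)⁻¹ := by
    refine (varModular_iSup_le hpm hp0 fun K => hf (k K) K).trans ?_
    rw [← ENNReal.tsum_geometric, ← ENNReal.tsum_mul_left]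
    exact ENNReal.tsum_le_tsum fun K => hfM _ _
  have hF₂ : varModular μ p F₂ ≤ M * (1 - θ)⁻¹ := by
    refine (varModular_iSup_le hpm hp0 fun K => hf (k K) (K + 1)).trans ?_
    rw [← ENNReal.tsum_geometric, ← ENNReal.tsum_mul_left]
    refine ENNReal.tsum_le_tsum fun K => (hfM _ _).trans ?_
    gcongr 1
    exact pow_le_pow_of_le_one zero_le hθ.le (Nat.le_succ K)
  have hF₁m : Measurable F₁ := .iSup fun K => hf (k K) K
  have hF₂m : Measurable F₂ := .iSup fun K => hf (k K) (K + 1)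
  let C : X → ℝ≥0∞ := fun x => lam * (2 * F₁ x + 2 * F₂ x + 4)
  have hCtop : ∀ᵐ x ∂μ, C x ≠ ⊤ := by
    filter_upwards [ae_lt_top_of_varModular hκ hp hF₁m (hF₁.trans_lt hsum),
      ae_lt_top_of_varModular hκ hp hF₂m (hF₂.trans_lt hsum)] with x h1 h2
    exact (ENNReal.mul_lt_top hlam (ENNReal.add_lt_top.2 ⟨ENNReal.add_lt_top.2
      ⟨ENNReal.mul_lt_top (by simp) h1, ENNReal.mul_lt_top (by simp) h2⟩, by simp⟩)).ne
  have hVV : ∀ᵐ x ∂μ, ∀ K, edist (V K x) (V (K + 1) x) ≤ C x * τ ^ K := by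
    refine ae_all_iff.2 fun K => ?_
    filter_upwards [hwV K _ (le_max_left _ (n₀ (K + 1))),
      hwV (K + 1) _ (le_max_right (n₀ K) _)] with x h1 h2
    have h3 : f (k K) K x ≤ F₁ x := le_iSup (fun K => f (k K) K x) K
    have h4 : f (k K) (K + 1) x ≤ F₂ x := le_iSup (fun K => f (k K) (K + 1) x) K
    calc edist (V K x) (V (K + 1) x) ≤ edist (w (k K) x) (V K x) + edist (w (k K) x) (V (K + 1) x) :=
          edist_triangle_left _ _ _
      _ ≤ lam * τ ^ K * (2 * F₁ x + 2) + lam * τ ^ K * (2 * F₂ x + 2) := by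
          refine add_le_add (h1.trans ?_) (h2.trans ?_)
          · gcongr
          · have : τ ^ (K + 1) ≤ τ ^ K := pow_le_pow_of_le_one zero_le hτ.le (Nat.le_succ K)
            gcongr
      _ = C x * τ ^ K := by ring
  obtain ⟨v, hv, hvlim⟩ := measurable_limit_of_tendsto_metrizable_ae (μ := μ) (f := V) (L := atTop)
    (fun K => ((measurable_of_countable fun i => a (K, i)).comp (hidx K)).aemeasurable)
    (by
      filter_upwards [hVV, hCtop] with x h1 h2
      exact cauchySeq_tendsto_of_complete (cauchySeq_of_edist_le_geometric τ (C x) hτ h2 h1))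
  have hinvτ : 1 ≤ (1 - τ)⁻¹ := ENNReal.one_le_inv.2 tsub_le_self
  have hlim : Tendsto (fun n => varLpNorm μ p (fun x => edist (w (φ n) x) (v x))) atTop (𝓝 0) := by
    refine tendsto_varLpNorm_zero hκ hp hτ (Λ := 12 * lam * (1 - τ)⁻¹)
      (M := M + M * (1 - θ)⁻¹ + M * (1 - θ)⁻¹ + μ univ)
      (ENNReal.mul_lt_top (ENNReal.mul_lt_top (by simp) hlam) (by simpa using hτ)) ?_ _ ?_
    · exact ENNReal.add_lt_top.2 ⟨ENNReal.add_lt_top.2 ⟨ENNReal.add_lt_top.2 ⟨hM, hsum⟩, hsum⟩, hfin⟩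
    intro K
    filter_upwards [eventually_ge_atTop (n₀ K)] with n hn
    -- A maximum in place of a sum, to suit `varModular_sup_le`. The modular of the constant `1` is
    -- at most `μ univ`, one of the uses of finiteness of the measure.
    refine ⟨fun x => f (φ n) K x ⊔ F₁ x ⊔ F₂ x ⊔ 1, ?_, ?_⟩
    · refine (varModular_sup_le hpm hp0 (((hf _ _).sup hF₁m).sup hF₂m) measurable_const).trans ?_
      refine add_le_add ((varModular_sup_le hpm hp0 ((hf _ _).sup hF₁m) hF₂m).trans
        (add_le_add ((varModular_sup_le hpm hp0 (hf _ _) hF₁m).trans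
          (add_le_add (hfM' _ _) hF₁)) hF₂)) ?_
      calc varModular μ p (fun _ => 1) ≤ ∫⁻ _, 1 ∂μ :=
            lintegral_mono fun x => expPhi_le_one _ le_rfl
        _ = μ univ := by simp
    · filter_upwards [hwV K n hn, hVV, hvlim] with x h1 h2 h3
      have h4 := edist_le_of_edist_le_geometric_of_tendsto τ (C x) h2 h3 K
      set S := f (φ n) K x ⊔ F₁ x ⊔ F₂ x ⊔ 1
      have s1 : f (φ n) K x ≤ S := le_sup_of_le_left (le_sup_of_le_left le_sup_left)
      have s2 : F₁ x ≤ S := le_sup_of_le_left (le_sup_of_le_left le_sup_right)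
      have s3 : F₂ x ≤ S := le_sup_of_le_left le_sup_right
      have s4 : 1 ≤ S := le_sup_right
      have hC : C x ≤ lam * (8 * S) := by
        calc C x = lam * (2 * F₁ x + 2 * F₂ x + 4 * 1) := by simp [C]
          _ ≤ lam * (2 * S + 2 * S + 4 * S) := by gcongr
          _ = lam * (8 * S) := by ring
      calc edist (w (φ n) x) (v x) ≤ edist (w (φ n) x) (V K x) + edist (V K x) (v x) :=
            edist_triangle _ _ _
        _ ≤ lam * τ ^ K * (2 * f (φ n) K x + 2 * 1) * 1 + C x * τ ^ K * (1 - τ)⁻¹ := by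
            rw [mul_one, mul_one, ← div_eq_mul_inv]
            exact add_le_add h1 h4
        _ ≤ lam * τ ^ K * (2 * S + 2 * S) * (1 - τ)⁻¹ + lam * (8 * S) * τ ^ K * (1 - τ)⁻¹ := by
            gcongr
        _ = 12 * lam * (1 - τ)⁻¹ * τ ^ K * S := by ring
  refine ⟨v, φ, hv, hφ, ?_, hlim⟩
  obtain ⟨n, hn⟩ := (hlim.eventually (gt_mem_nhds one_pos)).exists
  have h1 := varModular_div_le_one_of_varLpNorm_lt hn
  simp only [div_one] at h1
  -- Halving turns the sum of `‖w‖ₑ / lam` and the distance to `v` into an average, which is at most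
  -- their maximum.
  refine ⟨min 1 lam⁻¹ / 2, ENNReal.half_pos (by simp [hlam.ne]),
    (ENNReal.half_le_self.trans (min_le_left _ _)).trans_lt ENNReal.one_lt_top, ?_⟩
  refine lt_of_le_of_lt ?_ (ENNReal.add_lt_top.2 ⟨hM, ENNReal.one_lt_top⟩)
  refine le_trans (varModular_mono_ae (ae_of_all _ fun x => ?_))
    ((varModular_sup_le (μ := μ) hpm hp0 ((hw (φ n)).enorm.div_const lam)
      ((hw (φ n)).edist hv)).trans (add_le_add (hwM _) h1))
  have h5 : ‖v x‖ₑ ≤ ‖w (φ n) x‖ₑ + edist (w (φ n) x) (v x) := by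
    rw [← edist_zero_right, ← edist_zero_right, add_comm]
    exact edist_triangle_left _ _ _
  set A := ‖w (φ n) x‖ₑ
  set E := edist (w (φ n) x) (v x)
  calc min 1 lam⁻¹ / 2 * ‖v x‖ₑ ≤ min 1 lam⁻¹ / 2 * (A + E) := by gcongr
    _ = (min 1 lam⁻¹ * A + min 1 lam⁻¹ * E) / 2 := by
        simp only [div_eq_mul_inv]; ring
    _ ≤ (A / lam + E) / 2 := by
        gcongr
        · rw [div_eq_mul_inv, mul_comm]; gcongr; exact min_le_right _ _
        · exact mul_le_of_le_one_left' (min_le_left _ _)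
    _ ≤ (A / lam ⊔ E + A / lam ⊔ E) / 2 := by
        gcongr
        · exact le_sup_left
        · exact le_sup_right
    _ = A / lam ⊔ E := by rw [ENNReal.add_div, ENNReal.add_halves]

/-! ### Conversions for extended reals and powers -/

lemma EReal.abs_coe_sub_coe (x y : ℝ) : ((x : EReal) - y).abs = edist x y := by
  rw [← EReal.coe_sub, EReal.abs_def, edist_eq_enorm_sub, Real.enorm_eq_ofReal_abs]

lemma EReal.abs_coe_eq_enorm (x : ℝ) : (x : EReal).abs = ‖x‖ₑ := by
  rw [EReal.abs_def, Real.enorm_eq_ofReal_abs]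

lemma ENNReal.pow_rpow_comm (a : ℝ≥0∞) (n : ℕ) (κ : ℝ) : (a ^ n) ^ κ = (a ^ κ) ^ n := by
  rw [← ENNReal.rpow_natCast, ← ENNReal.rpow_natCast, ← ENNReal.rpow_mul, ← ENNReal.rpow_mul,
    mul_comm]

/-! ### Vector gradients with bounded semi-modulars -/

lemma le_seqNorm {q : ℝ≥0∞} (hq : 0 < q) (f : ℤ → ℝ≥0∞) (k : ℤ) : f k ≤ seqNorm q f := by
  unfold seqNorm
  split_ifs with h
  · exact le_iSup f k
  · rw [one_div, ENNReal.le_rpow_inv_iff (ENNReal.toReal_pos hq.ne' h)]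
    exact ENNReal.le_tsum (f := fun k => f k ^ q.toReal) k

lemma toReal_inv_le_inv {q : ℝ≥0∞} {r : ℝ} (hr : 0 < r) (h : ENNReal.ofReal r ≤ q) :
    (q⁻¹).toReal ≤ r⁻¹ := by
  have h1 : q⁻¹ ≤ (ENNReal.ofReal r)⁻¹ := ENNReal.inv_le_inv.2 h
  rw [← ENNReal.ofReal_inv_of_pos hr] at h1
  exact (ENNReal.toReal_mono ENNReal.ofReal_ne_top h1).trans_eq
    (ENNReal.toReal_ofReal (inv_pos.2 hr).le)

section

variable {X : Type*} [MetricSpace X] [MeasurableSpace X] {μ : Measure X} {s p q : X → ℝ≥0∞}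

lemma exists_gradient_of_homTLNorm_lt (hq : ∀ x, 0 < q x) {u : X → EReal} {c : ℝ≥0∞}
    (h : homTLNorm μ s p q u < c) :
    ∃ g ∈ vectorGradients μ s u, ∀ k, varModular μ p (fun x => g k x / c) ≤ 1 := by
  simp only [homTLNorm, iInf_lt_iff] at h
  obtain ⟨g, hg, hgc⟩ := h
  refine ⟨g, hg, fun k => le_trans (varModular_mono_ae (ae_of_all _ fun x => ?_))
    (varModular_div_le_one_of_varLpNorm_lt hgc)⟩
  exact ENNReal.div_le_div_right (le_seqNorm (hq x) (fun k => g k x) k) _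

/-- Each summand of the mixed modular is an infimum at most `1`, possibly not attained; some
admissible `e < 2` exists, and `e ^ (1 / q) ≤ 2 ^ (1 / r)` uniformly because `q ≥ r`. -/
lemma exists_gradient_of_homBesovNorm_lt {r : ℝ} (hr : 0 < r)
    (hq : ∀ᵐ x ∂μ, ENNReal.ofReal r ≤ q x) {u : X → EReal} {c : ℝ≥0∞}
    (h : homBesovNorm μ s p q u < c) :
    ∃ g ∈ vectorGradients μ s u, ∀ k, varModular μ p (fun x => g k x / (c * 2 ^ r⁻¹)) ≤ 1 := by
  simp only [homBesovNorm, iInf_lt_iff] at h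
  obtain ⟨g, hg, hgc⟩ := h
  obtain ⟨b, ⟨hb0, hb, hbg⟩, hbc⟩ := sInf_lt_iff.1 hgc
  refine ⟨g, hg, fun k => ?_⟩
  have hk := (ENNReal.le_tsum k).trans hbg
  obtain ⟨e, ⟨he0, he, hee⟩, he2⟩ := sInf_lt_iff.1 (hk.trans_lt ENNReal.one_lt_two)
  refine le_trans (varModular_mono_ae (hq.mono fun x hx => ?_)) hee
  have h1 : e ^ ((q x)⁻¹).toReal ≤ 2 ^ r⁻¹ :=
    (ENNReal.rpow_le_rpow he2.le ENNReal.toReal_nonneg).trans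
      (ENNReal.rpow_le_rpow_of_exponent_le ENNReal.one_lt_two.le (toReal_inv_le_inv hr hx))
  change g k x / (c * 2 ^ r⁻¹) ≤ g k x / b / e ^ ((q x)⁻¹).toReal
  rw [div_eq_mul_inv, div_eq_mul_inv, div_eq_mul_inv, mul_assoc,
    ← ENNReal.mul_inv (Or.inl hb0.ne') (Or.inl hb.ne)]
  gcongr

end

/-- The key estimate: oscillation of a function at scale `2 ^ (-K)` from a vector gradient. -/
lemma edist_le_of_vectorGradient {X : Type*} [MetricSpace X] {u : X → ℝ} {s : X → ℝ≥0∞}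
    {g : ℤ → X → ℝ≥0∞} {σ : ℝ} (hσ : 0 < σ) {x y : X}
    (hsx : ENNReal.ofReal (σ + σ) ≤ s x) (hsx' : s x < ⊤)
    (hsy : ENNReal.ofReal (σ + σ) ≤ s y) (hsy' : s y < ⊤)
    (h : ∀ k : ℤ, (2 : ℝ) ^ (-k - 1) ≤ dist x y → dist x y < (2 : ℝ) ^ (-k) →
      edist (u x) (u y) ≤ edist x y ^ (s x).toReal * g k x + edist x y ^ (s y).toReal * g k y)
    {K : ℕ} (hK : dist x y < (1 / 2) ^ K) {lam : ℝ≥0∞} (hl0 : 0 < lam) (hlam : lam < ⊤) :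
    edist (u x) (u y) ≤
      lam * (2⁻¹ ^ σ) ^ K * (⨆ j : ℕ, (2⁻¹ ^ σ) ^ (K + j) * (g ((K + j : ℕ) : ℤ) x / lam)) +
      lam * (2⁻¹ ^ σ) ^ K * (⨆ j : ℕ, (2⁻¹ ^ σ) ^ (K + j) * (g ((K + j : ℕ) : ℤ) y / lam)) := by
  rcases eq_or_ne x y with rfl | hxy
  · simp
  -- Here `2 ^ n ≤ dist x y < 2 ^ (n + 1)`, so the relevant gradient index is `-n - 1`; it is at
  -- least `K` because `n < -K`.
  obtain ⟨n, hn1, hn2⟩ := exists_mem_Ico_zpow (dist_pos.2 hxy) (one_lt_two : (1 : ℝ) < 2)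
  have hnK : n < -(K : ℤ) := by
    have : (2 : ℝ) ^ n < 2 ^ (-(K : ℤ)) := by
      refine hn1.trans_lt (hK.trans_eq ?_)
      rw [zpow_neg, zpow_natCast, one_div, inv_pow]
    exact (zpow_lt_zpow_iff_right₀ one_lt_two).1 this
  obtain ⟨j, hj⟩ : ∃ j : ℕ, -n - 1 = ((K + j : ℕ) : ℤ) := ⟨(-n - 1 - K).toNat, by push_cast; omega⟩
  have hk := h (-n - 1) (by rwa [show -(-n - 1) - 1 = n by ring])
    (by rwa [show -(-n - 1) = n + 1 by ring])
  rw [hj] at hk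
  have hτ : (2⁻¹ : ℝ≥0∞) ^ σ ≤ 1 := ENNReal.rpow_le_one (by simp) hσ.le
  have hd : edist x y ≤ 2⁻¹ ^ (K + j) := by
    rw [edist_dist]
    refine ENNReal.ofReal_le_of_le_toReal ?_
    have h1 : n + 1 = -((K + j : ℕ) : ℤ) := by omega
    rw [h1, zpow_neg, zpow_natCast, ← inv_pow] at hn2
    simpa using hn2.le
  have hd1 : edist x y ≤ 1 := hd.trans (pow_le_one₀ zero_le (by simp))
  have key : ∀ z, ENNReal.ofReal (σ + σ) ≤ s z → s z < ⊤ →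
      edist x y ^ (s z).toReal * g ((K + j : ℕ) : ℤ) z ≤
      lam * (2⁻¹ ^ σ) ^ K *
        (⨆ j : ℕ, (2⁻¹ ^ σ) ^ (K + j) * (g ((K + j : ℕ) : ℤ) z / lam)) := by
    intro z hz hz'
    -- The smoothness `2σ` is split: one `σ` gives the rate in `K`, the other the weight that makes
    -- the supremum over `j` have finite modular.
    have h1 : edist x y ^ (s z).toReal ≤ (2⁻¹ ^ σ) ^ K * (2⁻¹ ^ σ) ^ (K + j) := by
      calc edist x y ^ (s z).toReal ≤ edist x y ^ (σ + σ) :=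
            ENNReal.rpow_le_rpow_of_exponent_ge hd1 ((ENNReal.ofReal_le_iff_le_toReal hz'.ne).1 hz)
        _ ≤ (2⁻¹ ^ (K + j)) ^ (σ + σ) := ENNReal.rpow_le_rpow hd (by positivity)
        _ = (2⁻¹ ^ σ) ^ (K + j) * (2⁻¹ ^ σ) ^ (K + j) := by
            rw [ENNReal.rpow_add_of_nonneg _ _ hσ.le hσ.le]
            rw [ENNReal.pow_rpow_comm]
        _ ≤ _ := by
            gcongr 1
            exact pow_le_pow_of_le_one zero_le hτ (Nat.le_add_right K j)
    calc edist x y ^ (s z).toReal * g ((K + j : ℕ) : ℤ) z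
        ≤ ((2⁻¹ ^ σ) ^ K * (2⁻¹ ^ σ) ^ (K + j)) * (lam * (g ((K + j : ℕ) : ℤ) z / lam)) := by
          rw [ENNReal.mul_div_cancel hl0.ne' hlam.ne]
          gcongr
      _ = lam * (2⁻¹ ^ σ) ^ K * ((2⁻¹ ^ σ) ^ (K + j) * (g ((K + j : ℕ) : ℤ) z / lam)) := by ring
      _ ≤ _ := by
          gcongr
          exact le_iSup (fun j : ℕ => (2⁻¹ ^ σ) ^ (K + j) * (g ((K + j : ℕ) : ℤ) z / lam)) j
  exact hk.trans (add_le_add (key x hsx hsx') (key y hsy hsy'))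

/-! ### Compact embeddings over finite measures -/

theorem isCompactlyEmbeddedInVarLp_of_gradients {X : Type*} [MetricSpace X] [MeasurableSpace X]
    [BorelSpace X] {μ : Measure X} (hfin : μ univ < ⊤)
    (hinf : ∀ r : ℝ, 0 < r → r < 1 → 0 < ⨅ x : X, μ (Metric.ball x r)) {p s : X → ℝ≥0∞}
    (hp : IsBddVarExponent μ p) (hs : IsBddVarExponent μ s) {A : Set (X → EReal)}
    {normA : (X → EReal) → ℝ≥0∞} (hA : A ⊆ VarLp μ p) (hAfin : ∀ u ∈ A, AEFiniteMeasurable μ u)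
    (hnorm : ∀ u, varLpNorm μ p (fun x => (u x).abs) ≤ normA u)
    (hgrad : ∀ C < ⊤, ∃ lam : ℝ≥0∞, lam < ⊤ ∧ ∀ u ∈ A, normA u ≤ C →
      ∃ g ∈ vectorGradients μ s u, ∀ k, varModular μ p (fun x => g k x / lam) ≤ 1) :
    IsCompactlyEmbeddedInVarLp μ A normA p := by
  refine ⟨hA, ⟨1, ENNReal.one_lt_top, fun u _ => by simpa using hnorm u⟩, ?_⟩
  rintro u huA ⟨C, hC, hu⟩
  obtain ⟨κ, hκ, hpκ⟩ := exists_ofReal_le_ae hp.1.2.2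
  obtain ⟨σ₀, hσ₀, hsσ₀⟩ := exists_ofReal_le_ae hs.1.2.2
  obtain ⟨σ, hσ, rfl⟩ : ∃ σ : ℝ, 0 < σ ∧ σ₀ = σ + σ := ⟨σ₀ / 2, by positivity, by ring⟩
  obtain ⟨lam₀, hlam₀, hlg⟩ := hgrad C hC
  choose g hg hgl using fun n => hlg (u n) (huA n) (hu n)
  -- One scale for gradients and functions; the `+ 1` gives a strict inequality, as the Luxemburg
  -- infimum need not be attained.
  set lam := max lam₀ (C + 1)
  have hlam : lam < ⊤ := max_lt hlam₀ (ENNReal.add_lt_top.2 ⟨hC, ENNReal.one_lt_top⟩)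
  have hl0 : 0 < lam := lt_max_of_lt_right (by simp)
  set τ : ℝ≥0∞ := 2⁻¹ ^ σ with hτdef
  have hτ : τ < 1 := ENNReal.rpow_lt_one (by simp) hσ
  have hτ0 : 0 < τ := ENNReal.rpow_pos (by simp) (by simp)
  have hθ : τ ^ κ < 1 := ENNReal.rpow_lt_one hτ hκ
  choose hgm N hN hgN using hg
  have hsfin := ae_lt_top_of_essSup hs.2
  let w : ℕ → X → ℝ := fun n x => (u n x).toReal
  let f : ℕ → ℕ → X → ℝ≥0∞ := fun n K x => ⨆ j : ℕ, τ ^ (K + j) * (g n ((K + j : ℕ) : ℤ) x / lam)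
  let N' : ℕ → Set X := fun n =>
    N n ∪ {x | ¬ ((u n x ≠ ⊤ ∧ u n x ≠ ⊥) ∧ ENNReal.ofReal (σ + σ) ≤ s x ∧ s x < ⊤)}
  have hw : ∀ n, Measurable (w n) := fun n => (hAfin _ (huA n)).1.ereal_toReal
  have hwM : ∀ n, varModular μ p (fun x => ‖w n x‖ₑ / lam) ≤ (1 - τ ^ κ)⁻¹ := by
    intro n
    refine le_trans (le_trans (varModular_mono_ae ?_) (varModular_div_le_one_of_varLpNorm_lt
      (((hnorm (u n)).trans (hu n)).trans_lt (ENNReal.lt_add_right hC.ne one_ne_zero))))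
      (ENNReal.one_le_inv.2 tsub_le_self)
    filter_upwards [(hAfin _ (huA n)).2] with x hx
    rw [← EReal.abs_coe_eq_enorm, EReal.coe_toReal hx.1 hx.2]
    exact ENNReal.div_le_div_left (le_max_right _ _) _
  have hf : ∀ n K, Measurable (f n K) := fun n K =>
    .iSup fun j => ((hgm n _).div_const _).const_mul _
  have hfM : ∀ n K, varModular μ p (f n K) ≤ (1 - τ ^ κ)⁻¹ * (τ ^ κ) ^ K := by
    intro n K
    refine (varModular_iSup_le hp.1.1 hp.1.2.1
      fun j => ((hgm n _).div_const _).const_mul _).trans ?_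
    rw [← ENNReal.tsum_geometric, ← ENNReal.tsum_mul_right]
    refine ENNReal.tsum_le_tsum fun j => ?_
    -- Each weight leaves the modular as `(τ ^ κ) ^ (K + j)`; summing over `j` gives the constant
    -- and leaves `(τ ^ κ) ^ K`.
    refine (varModular_const_mul_le hκ hpκ (pow_le_one₀ zero_le hτ.le) _).trans ?_
    have h1 : varModular μ p (fun x => g n ((K + j : ℕ) : ℤ) x / lam) ≤ 1 :=
      le_trans (varModular_mono_ae (ae_of_all _ fun x =>
        ENNReal.div_le_div_left (le_max_left _ _) _)) (hgl n _)
    calc (τ ^ (K + j)) ^ κ * _ ≤ (τ ^ (K + j)) ^ κ * 1 := by gcongr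
      _ = (τ ^ κ) ^ j * (τ ^ κ) ^ K := by
        rw [mul_one, ← pow_add, ENNReal.pow_rpow_comm, add_comm K j]
  have hN' : ∀ n, μ (N' n) = 0 := by
    intro n
    refine measure_union_null (hN n) (ae_iff.1 ?_)
    filter_upwards [(hAfin _ (huA n)).2, hsσ₀, hsfin] with x h1 h2 h3 using ⟨h1, h2, h3⟩
  have hwf : ∀ n K, ∀ x ∉ N' n, ∀ y ∉ N' n, dist x y < (1 / 2) ^ K →
      edist (w n x) (w n y) ≤ lam * τ ^ K * f n K x + lam * τ ^ K * f n K y := by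
    intro n K x hx y hy hxy
    simp only [N', mem_union, mem_ofPred_eq, not_or, not_not] at hx hy
    obtain ⟨hxN, hxu, hxs, hxs'⟩ := hx
    obtain ⟨hyN, hyu, hys, hys'⟩ := hy
    refine edist_le_of_vectorGradient hσ hxs hxs' hys hys' (fun k hk1 hk2 => ?_) hxy hl0 hlam
    have := hgN n k x hxN y hyN hk1 hk2
    rwa [← EReal.coe_toReal hxu.1 hxu.2, ← EReal.coe_toReal hyu.1 hyu.2,
      EReal.abs_coe_sub_coe] at this
  obtain ⟨v, φ, hv, hφ, hvc, hlim⟩ := exists_subseq_tendsto_varLpNorm hfin hinf hp.1.1 hp.1.2.1 hκ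
    hpκ hτ0 hτ hθ hl0 hlam (by simpa using hθ) w hw hwM f hf hfM N' hN' hwf
  refine ⟨fun x => (v x : EReal), ⟨measurable_coe_real_ereal.comp hv, ?_⟩, φ, hφ, ?_⟩
  · simpa only [EReal.abs_coe_eq_enorm] using hvc
  · refine hlim.congr fun n => ?_
    unfold varLpNorm
    congr 1
    ext c
    simp only [mem_ofPred_eq]
    rw [varModular_congr_ae (g := fun x => ((u (φ n) x : EReal) - v x).abs / c)]
    filter_upwards [(hAfin _ (huA (φ n))).2] with x hx
    rw [← EReal.abs_coe_sub_coe, EReal.coe_toReal hx.1 hx.2]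

theorem tlCompactEmbedding_of_finite {X : Type*} [MetricSpace X] [MeasurableSpace X]
    [BorelSpace X] {μ : Measure X} (hfin : μ univ < ⊤)
    (hinf : ∀ r : ℝ, 0 < r → r < 1 → 0 < ⨅ x : X, μ (Metric.ball x r)) {p s q : X → ℝ≥0∞}
    (hp : IsBddVarExponent μ p) (hs : IsBddVarExponent μ s) (hq : IsVarExponent μ q) :
    TLCompactEmbedding μ s p q p := by
  refine isCompactlyEmbeddedInVarLp_of_gradients hfin hinf hp hs (fun u hu => hu.2)
    (fun u hu => hu.1.1) (fun u => le_self_add) fun C hC => ?_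
  refine ⟨C + 1, ENNReal.add_lt_top.2 ⟨hC, ENNReal.one_lt_top⟩, fun u _ huC => ?_⟩
  exact exists_gradient_of_homTLNorm_lt hq.2.1
    ((le_add_self.trans huC).trans_lt (ENNReal.lt_add_right hC.ne one_ne_zero))

theorem besovCompactEmbedding_of_finite {X : Type*} [MetricSpace X] [MeasurableSpace X]
    [BorelSpace X] {μ : Measure X} (hfin : μ univ < ⊤)
    (hinf : ∀ r : ℝ, 0 < r → r < 1 → 0 < ⨅ x : X, μ (Metric.ball x r)) {p s q : X → ℝ≥0∞}
    (hp : IsBddVarExponent μ p) (hs : IsBddVarExponent μ s) (hq : IsVarExponent μ q) :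
    BesovCompactEmbedding μ s p q p := by
  refine isCompactlyEmbeddedInVarLp_of_gradients hfin hinf hp hs (fun u hu => hu.2)
    (fun u hu => hu.1.1) (fun u => le_self_add) fun C hC => ?_
  obtain ⟨r, hr, hqr⟩ := exists_ofReal_le_ae hq.2.2
  refine ⟨(C + 1) * 2 ^ r⁻¹, ENNReal.mul_lt_top (ENNReal.add_lt_top.2 ⟨hC, ENNReal.one_lt_top⟩)
    (ENNReal.rpow_lt_top_of_nonneg (inv_pos.2 hr).le (by simp)), fun u _ huC => ?_⟩
  exact exists_gradient_of_homBesovNorm_lt hr hqr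
    ((le_add_self.trans huC).trans_lt (ENNReal.lt_add_right hC.ne one_ne_zero))

/-! ### Bump functions -/

/-- The `4`-Lipschitz bump function of height one supported in the ball of radius `1 / 4`. -/
noncomputable def bump {X : Type*} [MetricSpace X] (x₀ x : X) : ℝ := max 0 (1 - 4 * dist x x₀)

section Bump

variable {X : Type*} [MetricSpace X]

lemma bump_nonneg (x₀ x : X) : 0 ≤ bump x₀ x := le_max_left _ _

lemma bump_le_one (x₀ x : X) : bump x₀ x ≤ 1 :=
  max_le zero_le_one (by linarith [dist_nonneg (x := x) (y := x₀)])

lemma bump_eq_zero {x₀ x : X} (h : 1 / 4 ≤ dist x x₀) : bump x₀ x = 0 :=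
  max_eq_left (by linarith)

lemma half_le_bump {x₀ x : X} (h : dist x x₀ < 1 / 8) : 1 / 2 ≤ bump x₀ x :=
  le_max_of_le_right (by linarith)

lemma continuous_bump (x₀ : X) : Continuous (bump x₀) := by
  unfold bump
  fun_prop

lemma abs_bump_sub_bump_le (x₀ x y : X) : |bump x₀ x - bump x₀ y| ≤ min 1 (4 * dist x y) := by
  refine le_min ?_ ?_
  · rw [abs_le]
    constructor <;> linarith [bump_nonneg x₀ x, bump_nonneg x₀ y, bump_le_one x₀ x, bump_le_one x₀ y]
  · refine (abs_max_sub_max_le_max _ _ _ _).trans ?_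
    refine max_le (by simp) ?_
    have := abs_dist_sub_le x y x₀
    rw [abs_le] at this ⊢
    constructor <;> linarith [this.1, this.2]

lemma enorm_bump_le_indicator (x₀ x : X) :
    ‖bump x₀ x‖ₑ ≤ (Metric.ball x₀ 1).indicator (fun _ => 1) x := by
  by_cases hx : x ∈ Metric.ball x₀ 1
  · rw [indicator_of_mem hx, Real.enorm_eq_ofReal_abs, abs_of_nonneg (bump_nonneg _ _)]
    exact ENNReal.ofReal_le_one.2 (bump_le_one _ _)
  · rw [bump_eq_zero (by rw [Metric.mem_ball] at hx; linarith)]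
    simp

end Bump

/-- The coefficients of a vector gradient of `bump`. -/
noncomputable def bumpCoeff (ε : ℝ) (k : ℤ) : ℝ≥0∞ :=
  4 * ENNReal.ofReal (2 ^ (-ε)) ^ k.natAbs

/-- At small scales the Lipschitz bound wins: `d ≤ d ^ t * d ^ ε` since `t + ε ≤ 1`. At large scales
the height bound wins: `1 ≤ d ^ t * d ^ (-ε)` since `ε ≤ t`. -/
lemma min_le_rpow_mul {d t ε : ℝ} {k : ℤ} (hd0 : 0 < d) (hd1 : (2 : ℝ) ^ (-k - 1) ≤ d)
    (hd2 : d < (2 : ℝ) ^ (-k)) (hε : 0 ≤ ε) (ht1 : ε ≤ t) (ht2 : t ≤ 1 - ε) :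
    min 1 (4 * d) ≤ d ^ t * (4 * ((2 : ℝ) ^ (-ε)) ^ k.natAbs) := by
  have hpow : ∀ n : ℕ, ((2 : ℝ) ^ (-ε)) ^ n = ((2 : ℝ) ^ n) ^ (-ε) := fun n => by
    rw [← Real.rpow_natCast, ← Real.rpow_natCast, ← Real.rpow_mul two_pos.le,
      ← Real.rpow_mul two_pos.le, mul_comm]
  rw [hpow]
  obtain ⟨n, rfl | rfl⟩ := k.eq_nat_or_neg
  · refine (min_le_right _ _).trans ?_
    rw [zpow_neg, zpow_natCast] at hd2
    have hd3 : d ≤ 1 := hd2.le.trans (inv_le_one_of_one_le₀ (one_le_pow₀ one_le_two))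
    have h1 : d ^ ε ≤ ((2 : ℝ) ^ n) ^ (-ε) := by
      rw [Real.rpow_neg (by positivity), ← Real.inv_rpow (by positivity)]
      exact Real.rpow_le_rpow hd0.le hd2.le hε
    have h2 : d ≤ d ^ (t + ε) := by
      conv_lhs => rw [← Real.rpow_one d]
      exact Real.rpow_le_rpow_of_exponent_ge hd0 hd3 (by linarith)
    rw [Real.rpow_add hd0] at h2
    have h3 : d ^ t * d ^ ε ≤ d ^ t * ((2 : ℝ) ^ n) ^ (-ε) := by gcongr
    simp only [Int.natAbs_natCast]
    linarith
  · rcases Nat.eq_zero_or_pos n with rfl | hn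
    · refine (min_le_right _ _).trans ?_
      have hd3 : d ≤ 1 := by simpa using hd2.le
      have h2 : d ≤ d ^ t := by
        conv_lhs => rw [← Real.rpow_one d]
        exact Real.rpow_le_rpow_of_exponent_ge hd0 hd3 (by linarith)
      simpa [mul_comm] using h2
    refine (min_le_left _ _).trans ?_
    -- Comparing `d` with `2 ^ n` loses a factor `2 ^ (-ε) ≥ 1 / 2`, absorbed by the `4`.
    have hd3 : (2 : ℝ) ^ n ≤ 2 * d := by
      have h : -(-(n : ℤ)) - 1 = (n : ℤ) - 1 := by ring
      rw [h, zpow_sub_one₀ two_ne_zero, zpow_natCast] at hd1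
      linarith
    have hd4 : 1 ≤ d := by
      have : (2 : ℝ) ^ 1 ≤ 2 ^ n := pow_le_pow_right₀ one_le_two hn
      linarith
    have h1 : (2 * d) ^ (-ε) ≤ ((2 : ℝ) ^ n) ^ (-ε) :=
      Real.rpow_le_rpow_of_nonpos (by positivity) hd3 (by linarith)
    have h2 : 1 / 2 ≤ (2 : ℝ) ^ (-ε) := by
      rw [one_div, ← Real.rpow_neg_one]
      exact Real.rpow_le_rpow_of_exponent_le one_le_two (by linarith)
    rw [Real.mul_rpow two_pos.le hd0.le] at h1
    have h3 : 1 ≤ d ^ t * d ^ (-ε) := by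
      rw [← Real.rpow_add hd0]
      exact Real.one_le_rpow hd4 (by linarith)
    simp only [Int.natAbs_neg, Int.natAbs_natCast]
    calc (1 : ℝ) ≤ (4 * (1 / 2)) * (d ^ t * d ^ (-ε)) := by linarith
      _ ≤ (4 * 2 ^ (-ε)) * (d ^ t * d ^ (-ε)) := by gcongr
      _ = d ^ t * (4 * (2 ^ (-ε) * d ^ (-ε))) := by ring
      _ ≤ _ := by gcongr

section

variable {X : Type*} [MetricSpace X] [MeasurableSpace X] [BorelSpace X] {μ : Measure X}
  {s p q : X → ℝ≥0∞}

/-- The estimate holds with the exponent at either point alone, so one point in the unit ball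
suffices; if both lie outside, the bump vanishes at both. -/
lemma bump_vectorGradient {ε : ℝ} (hε : 0 ≤ ε)
    (hs : ∀ᵐ x ∂μ, ε ≤ (s x).toReal ∧ (s x).toReal ≤ 1 - ε) (x₀ : X) :
    (fun k => (Metric.ball x₀ 1).indicator fun _ => bumpCoeff ε k) ∈
      vectorGradients μ s (fun x => (bump x₀ x : EReal)) := by
  refine ⟨fun k => measurable_const.indicator measurableSet_ball, _, ae_iff.1 hs, ?_⟩
  intro k x hx y hy hd1 hd2
  simp only [mem_ofPred_eq, not_not] at hx hy
  have hd0 : 0 < dist x y := lt_of_lt_of_le (by positivity) hd1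
  have key : ∀ t : ℝ, ε ≤ t → t ≤ 1 - ε →
      edist (bump x₀ x) (bump x₀ y) ≤ edist x y ^ t * bumpCoeff ε k := by
    intro t ht1 ht2
    have h4 : (4 : ℝ≥0∞) = ENNReal.ofReal 4 := by simp
    rw [bumpCoeff, edist_dist x y, ENNReal.ofReal_rpow_of_pos hd0, ← ENNReal.ofReal_pow (by positivity),
      h4, ← ENNReal.ofReal_mul (by norm_num), ← ENNReal.ofReal_mul (by positivity), edist_dist,
      Real.dist_eq]
    exact ENNReal.ofReal_le_ofReal ((abs_bump_sub_bump_le x₀ x y).trans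
      (min_le_rpow_mul hd0 hd1 hd2 hε ht1 ht2))
  rw [EReal.abs_coe_sub_coe]
  beta_reduce
  by_cases hxb : x ∈ Metric.ball x₀ 1
  · rw [indicator_of_mem hxb]
    exact (key _ hx.1 hx.2).trans le_self_add
  by_cases hyb : y ∈ Metric.ball x₀ 1
  · rw [indicator_of_mem hyb]
    exact (key _ hy.1 hy.2).trans le_add_self
  rw [Metric.mem_ball] at hxb hyb
  rw [bump_eq_zero (x := x) (by linarith), bump_eq_zero (x := y) (by linarith)]
  simp

/-! ### Norm bounds for the bump functions -/

lemma tsum_pow_natAbs_lt_top {ρ : ℝ≥0∞} (hρ : ρ < 1) : ∑' k : ℤ, ρ ^ k.natAbs < ⊤ := by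
  rw [tsum_of_nat_of_neg_add_one ENNReal.summable ENNReal.summable]
  have h : ∑' n : ℕ, ρ ^ n < ⊤ := by
    rw [ENNReal.tsum_geometric]; simpa using hρ
  refine ENNReal.add_lt_top.2 ⟨by simpa using h, lt_of_le_of_lt ?_ h⟩
  refine ENNReal.tsum_le_tsum fun n => ?_
  have h1 : (-((n : ℤ) + 1)).natAbs = n + 1 := by omega
  rw [h1]
  exact pow_le_pow_of_le_one zero_le hρ.le (Nat.le_succ n)

/-- One sequence of weights, independent of the point, serves both norms: it bounds the pointwise
`ℓ^q` sums, and its terms are admissible in the Besov modular. For `q ≥ r` take `c k` proportional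
to `2 ^ (-ε r |k|)`; for `q = ∞` any positive summable weights do, as `c k ^ 0 = 1`. -/
lemma exists_weights {Y : Type*} [MeasurableSpace Y] {μ : Measure Y} {q : Y → ℝ≥0∞}
    {ε : ℝ} (hε : 0 ≤ ε)
    (h : (0 < ε ∧ ∃ r : ℝ, 0 < r ∧ ∀ᵐ x ∂μ, ENNReal.ofReal r ≤ q x) ∨ ∀ᵐ x ∂μ, q x = ⊤) :
    ∃ (L : ℝ≥0∞) (c : ℤ → ℝ≥0∞), 0 < L ∧ L < ⊤ ∧ (∀ k, 0 < c k) ∧ ∑' k, c k ≤ 1 ∧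
      ∀ᵐ x ∂μ, ∀ k, bumpCoeff ε k ≤ L * c k ^ ((q x)⁻¹).toReal := by
  rcases h with ⟨hε0, r, hr, hq⟩ | hq
  · set τ := ENNReal.ofReal ((2 : ℝ) ^ (-ε)) with hτdef
    have hτ0 : 0 < τ := ENNReal.ofReal_pos.2 (by positivity)
    have hτ : τ < 1 := by
      rw [hτdef, ENNReal.ofReal_lt_one]
      exact Real.rpow_lt_one_of_one_lt_of_neg one_lt_two (by linarith)
    set S := ∑' k : ℤ, (τ ^ r) ^ k.natAbs
    have hS : S < ⊤ := tsum_pow_natAbs_lt_top (ENNReal.rpow_lt_one hτ hr)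
    have hS1 : 1 ≤ S := by
      simpa using ENNReal.le_tsum (f := fun k : ℤ => (τ ^ r) ^ k.natAbs) 0
    have hS0 : S ≠ 0 := (one_pos.trans_le hS1).ne'
    have hSr0 : S ^ r⁻¹ ≠ 0 := (ENNReal.rpow_pos (pos_iff_ne_zero.2 hS0) hS.ne).ne'
    have hSr : S ^ r⁻¹ ≠ ⊤ := ENNReal.rpow_ne_top_of_nonneg (inv_pos.2 hr).le hS.ne
    refine ⟨4 * S ^ r⁻¹, fun k => (τ ^ r) ^ k.natAbs / S, ENNReal.mul_pos (by simp) hSr0,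
      ENNReal.mul_lt_top (by simp) hSr.lt_top, fun k => ENNReal.div_pos (ENNReal.pow_pos
        (ENNReal.rpow_pos hτ0 hτ.ne_top) _).ne' hS.ne, ?_, ?_⟩
    · simp only [div_eq_mul_inv]
      rw [ENNReal.tsum_mul_right, ENNReal.mul_inv_cancel hS0 hS.ne]
    · filter_upwards [hq] with x hx k
      have hc1 : (τ ^ r) ^ k.natAbs / S ≤ 1 := by
        refine ENNReal.div_le_of_le_mul ?_
        rw [one_mul]
        exact ENNReal.le_tsum (f := fun k : ℤ => (τ ^ r) ^ k.natAbs) k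
      calc bumpCoeff ε k = 4 * S ^ r⁻¹ * (τ ^ k.natAbs / S ^ r⁻¹) := by
            rw [mul_assoc, ENNReal.mul_div_cancel hSr0 hSr, bumpCoeff]
        _ = 4 * S ^ r⁻¹ * ((τ ^ r) ^ k.natAbs / S) ^ r⁻¹ := by
            rw [ENNReal.div_rpow_of_nonneg _ _ (inv_pos.2 hr).le, ENNReal.pow_rpow_comm,
              ← ENNReal.rpow_mul, mul_inv_cancel₀ hr.ne', ENNReal.rpow_one]
        _ ≤ _ := by
            gcongr 1
            exact ENNReal.rpow_le_rpow_of_exponent_ge hc1 (toReal_inv_le_inv hr hx)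
  · obtain ⟨c, hc0, hc⟩ := ENNReal.exists_pos_sum_of_countable' one_ne_zero ℤ
    refine ⟨4, c, by simp, by simp, hc0, hc.le, ?_⟩
    filter_upwards [hq] with x hx k
    rw [hx, bumpCoeff]
    simp only [ENNReal.inv_top, ENNReal.toReal_zero, ENNReal.rpow_zero]
    gcongr
    refine pow_le_one₀ zero_le (ENNReal.ofReal_le_one.2 ?_)
    exact Real.rpow_le_one_of_one_le_of_nonpos one_le_two (by linarith)

lemma seqNorm_le_of_weights {q L : ℝ≥0∞} (hq : 0 < q) {f c : ℤ → ℝ≥0∞} (hc : ∑' k, c k ≤ 1)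
    (h : ∀ k, f k ≤ L * c k ^ (q⁻¹).toReal) : seqNorm q f ≤ L := by
  unfold seqNorm
  split_ifs with hqt
  · exact iSup_le fun k => (h k).trans (by simp [hqt])
  · have hq0 : 0 < q.toReal := ENNReal.toReal_pos hq.ne' hqt
    rw [one_div, ENNReal.rpow_inv_le_iff hq0]
    calc ∑' k, f k ^ q.toReal ≤ ∑' k, L ^ q.toReal * c k := by
          refine ENNReal.tsum_le_tsum fun k => (ENNReal.rpow_le_rpow (h k) hq0.le).trans_eq ?_
          rw [ENNReal.mul_rpow_of_nonneg _ _ hq0.le, ← ENNReal.rpow_mul, ENNReal.toReal_inv,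
            inv_mul_cancel₀ hq0.ne', ENNReal.rpow_one]
      _ ≤ L ^ q.toReal := by
          rw [ENNReal.tsum_mul_left]
          exact mul_le_of_le_one_right' hc

lemma seqNorm_zero {q : ℝ≥0∞} (hq : 0 < q) : seqNorm q (fun _ => 0) = 0 :=
  nonpos_iff_eq_zero.1 (seqNorm_le_of_weights (c := fun _ => 0) hq (by simp) (by simp))

lemma exists_varModular_indicator_ball_le_one {κ : ℝ} (hκ : 0 < κ)
    (hp : ∀ᵐ x ∂μ, ENNReal.ofReal κ ≤ p x) (hp0 : ∀ x, 0 < p x)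
    (hsup : (⨆ x : X, μ (Metric.ball x 1)) < ⊤) :
    ∃ a : ℝ≥0∞, 0 < a ∧ a < 1 ∧ ∀ x₀ : X,
      varModular μ p (fun x => a * (Metric.ball x₀ 1).indicator (fun _ => 1) x) ≤ 1 := by
  obtain ⟨a, ha0, ha1, ha⟩ := exists_rpow_mul_le_one hκ hsup
  refine ⟨a, ha0, ha1, fun x₀ => (varModular_const_mul_le hκ hp ha1.le _).trans
    (le_trans ?_ ha)⟩
  gcongr
  refine le_trans ?_ (le_iSup (fun x : X => μ (Metric.ball x 1)) x₀)
  calc varModular μ p ((Metric.ball x₀ 1).indicator fun _ => 1)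
      ≤ ∫⁻ x, (Metric.ball x₀ 1).indicator (fun _ => 1) x ∂μ := by
        refine lintegral_mono fun x => ?_
        by_cases hx : x ∈ Metric.ball x₀ 1
        · simpa [hx] using expPhi_le_one (p x) le_rfl
        · simp [hx, expPhi_zero (hp0 x)]
    _ = μ (Metric.ball x₀ 1) := by
        rw [lintegral_indicator_const measurableSet_ball, one_mul]

lemma div_div_le_mul_of_le {L a b f i : ℝ≥0∞} (ha0 : 0 < a) (ha : a < ⊤) (h : f ≤ L * b * i) :
    f / (L / a) / b ≤ a * i := by
  refine ENNReal.div_le_of_le_mul (ENNReal.div_le_of_le_mul (h.trans_eq ?_))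
  calc L * b * i = (a * (L / a)) * b * i := by rw [ENNReal.mul_div_cancel ha0.ne' ha.ne]
    _ = _ := by ring

lemma varLpNorm_le_of_le_indicator {Y : Type*} [MetricSpace Y] [MeasurableSpace Y] {μ : Measure Y}
    {p : Y → ℝ≥0∞} {a L : ℝ≥0∞} (ha0 : 0 < a) (ha1 : a < 1) (hL0 : 0 < L)
    (hL : L < ⊤) {x₀ : Y}
    (ha : varModular μ p (fun x => a * (Metric.ball x₀ 1).indicator (fun _ => 1) x) ≤ 1)
    {f : Y → ℝ≥0∞} (hf : ∀ᵐ x ∂μ, f x ≤ L * (Metric.ball x₀ 1).indicator (fun _ => 1) x) :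
    varLpNorm μ p f ≤ L / a := by
  refine varLpNorm_le (ENNReal.div_pos hL0.ne' ha1.ne_top) (ENNReal.div_lt_top hL.ne ha0.ne')
    (le_trans (varModular_mono_ae (hf.mono fun x hx => ?_)) ha)
  rw [← mul_one L] at hx
  simpa only [div_one, mul_one] using div_div_le_mul_of_le ha0 ha1.lt_top hx

lemma aeFiniteMeasurable_bump (x₀ : X) : AEFiniteMeasurable μ (fun x => (bump x₀ x : EReal)) :=
  ⟨measurable_coe_real_ereal.comp (continuous_bump x₀).measurable, by simp⟩

lemma bump_mem_varLp {a : ℝ≥0∞} (ha0 : 0 < a) (ha1 : a < 1) {x₀ : X}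
    (ha : varModular μ p (fun x => a * (Metric.ball x₀ 1).indicator (fun _ => 1) x) ≤ 1) :
    (fun x => (bump x₀ x : EReal)) ∈ VarLp μ p := by
  refine ⟨(aeFiniteMeasurable_bump (μ := μ) x₀).1, a, ha0, ha1.lt_top, ?_⟩
  refine lt_of_le_of_lt (le_trans (varModular_mono_ae (ae_of_all _ fun x => ?_)) ha)
    ENNReal.one_lt_top
  rw [EReal.abs_coe_eq_enorm]
  gcongr
  exact enorm_bump_le_indicator x₀ x

lemma varLpNorm_bump_le {a : ℝ≥0∞} (ha0 : 0 < a) (ha1 : a < 1) {x₀ : X}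
    (ha : varModular μ p (fun x => a * (Metric.ball x₀ 1).indicator (fun _ => 1) x) ≤ 1) :
    varLpNorm μ p (fun x => (bump x₀ x : EReal).abs) ≤ 1 / a := by
  refine varLpNorm_le_of_le_indicator ha0 ha1 one_pos ENNReal.one_lt_top ha (ae_of_all _ fun x => ?_)
  rw [one_mul, EReal.abs_coe_eq_enorm]
  exact enorm_bump_le_indicator x₀ x

/-- Uniform bounds for the homogeneous quasi-norms of the bump functions. -/
lemma exists_homNorm_bump_le {ε : ℝ} (hε : 0 ≤ ε)
    (hs : ∀ᵐ x ∂μ, ε ≤ (s x).toReal ∧ (s x).toReal ≤ 1 - ε) (hq0 : ∀ x, 0 < q x)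
    (h : (0 < ε ∧ ∃ r : ℝ, 0 < r ∧ ∀ᵐ x ∂μ, ENNReal.ofReal r ≤ q x) ∨ ∀ᵐ x ∂μ, q x = ⊤)
    {a : ℝ≥0∞} (ha0 : 0 < a) (ha1 : a < 1)
    (ha : ∀ x₀, varModular μ p (fun x => a * (Metric.ball x₀ 1).indicator (fun _ => 1) x) ≤ 1) :
    ∃ C : ℝ≥0∞, C < ⊤ ∧ ∀ x₀ : X, homTLNorm μ s p q (fun x => (bump x₀ x : EReal)) ≤ C ∧
      homBesovNorm μ s p q (fun x => (bump x₀ x : EReal)) ≤ C := by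
  obtain ⟨L, c, hL0, hL, hc0, hc, hLc⟩ := exists_weights hε h
  have hLa : L / a < ⊤ := ENNReal.div_lt_top hL.ne ha0.ne'
  refine ⟨L / a, hLa, fun x₀ => ⟨(iInf₂_le _ (bump_vectorGradient hε hs x₀)).trans ?_,
    (iInf₂_le _ (bump_vectorGradient hε hs x₀)).trans ?_⟩⟩
  · refine varLpNorm_le_of_le_indicator ha0 ha1 hL0 hL (ha x₀) ?_
    filter_upwards [hLc] with x hx
    by_cases hxb : x ∈ Metric.ball x₀ 1
    · simpa [hxb] using seqNorm_le_of_weights (hq0 x) hc hx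
    · simp [hxb, seqNorm_zero (hq0 x)]
  · refine sInf_le ⟨ENNReal.div_pos hL0.ne' ha1.ne_top, hLa, ?_⟩
    refine le_trans (ENNReal.tsum_le_tsum fun k => ?_) hc
    have hck : c k < ⊤ := ((ENNReal.le_tsum k).trans hc).trans_lt ENNReal.one_lt_top
    refine sInf_le ⟨hc0 k, hck, le_trans (varModular_mono_ae ?_) (ha x₀)⟩
    filter_upwards [hLc] with x hx
    refine div_div_le_mul_of_le ha0 ha1.lt_top ?_
    by_cases hxb : x ∈ Metric.ball x₀ 1
    · simpa [hxb] using hx k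
    · simp [hxb]

/-! ### Failure of compactness over infinite measures -/

lemma quarter_le_abs_sub_or {a : ℝ} (ha : 1 / 2 ≤ a) (v : EReal) :
    (v ≤ ((1 / 4 : ℝ) : EReal) → ENNReal.ofReal (1 / 4) ≤ ((a : EReal) - v).abs) ∧
      (((1 / 4 : ℝ) : EReal) ≤ v → ENNReal.ofReal (1 / 4) ≤ (((0 : ℝ) : EReal) - v).abs) := by
  induction v with
  | bot => simp
  | top => simp
  | coe v =>
    simp only [EReal.coe_le_coe_iff, ← EReal.coe_sub, EReal.abs_def]
    refine ⟨fun h => ENNReal.ofReal_le_ofReal (le_abs.2 (Or.inl (by linarith))),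
      fun h => ENNReal.ofReal_le_ofReal (le_abs.2 (Or.inr (by linarith)))⟩

/-- Two consecutive terms suffice. On the ball `B` about the first centre one bump is at least `1/2`
and the other is zero, so at each point the limit `v` misses one of them by `1/4`. One of these two
sets has at least half the measure of `B`, contradicting Chebyshev. -/
theorem not_isCompactlyEmbeddedInVarLp {β : X → ℝ≥0∞} (hβ : IsVarExponent μ β)
    (hinf : 0 < ⨅ x : X, μ (Metric.ball x (1 / 8))) {A : Set (X → EReal)}
    {normA : (X → EReal) → ℝ≥0∞} {x : ℕ → X} (hx : ∀ m n, m ≠ n → 1 ≤ dist (x m) (x n))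
    (hA : ∀ n, (fun y => (bump (x n) y : EReal)) ∈ A) {C : ℝ≥0∞} (hC : C < ⊤)
    (hnorm : ∀ n, normA (fun y => (bump (x n) y : EReal)) ≤ C) :
    ¬ IsCompactlyEmbeddedInVarLp μ A normA β := by
  rintro ⟨-, -, h⟩
  obtain ⟨v, ⟨hv, -⟩, m, hm, hlim⟩ := h _ hA ⟨C, hC, hnorm⟩
  obtain ⟨κ, hκ, hβκ⟩ := exists_ofReal_le_ae hβ.2.2
  set δ := ⨅ x : X, μ (Metric.ball x (1 / 8))
  -- With `t ^ κ * (δ / 2) > 1` and `b = 1 / (4t)`, norm below `b` forces the set where the error is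
  -- at least `1/4` to have measure below `δ / 2`.
  obtain ⟨t, ht1, ht, htδ⟩ := exists_lt_rpow_mul hκ (ENNReal.half_pos hinf.ne') ENNReal.one_lt_top
  set b : ℝ≥0∞ := ENNReal.ofReal (1 / 4) / t
  have hb0 : 0 < b := ENNReal.div_pos (by simp) ht.ne
  have hb : b < ⊤ := ENNReal.div_lt_top ENNReal.ofReal_ne_top (one_pos.trans ht1).ne'
  have htb : t * b = ENNReal.ofReal (1 / 4) := ENNReal.mul_div_cancel (one_pos.trans ht1).ne' ht.ne
  obtain ⟨n, hn⟩ := eventually_atTop.1 (hlim.eventually (gt_mem_nhds hb0))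
  have key : ∀ k ≥ n, ∀ S : Set X, MeasurableSet S →
      (∀ y ∈ S, ENNReal.ofReal (1 / 4) ≤ ((bump (x (m k)) y : EReal) - v y).abs) →
      μ S < δ / 2 := by
    intro k hk S hS hSv
    by_contra hcon
    push Not at hcon
    have h1 := rpow_mul_measure_le_varModular hβκ ht1
      (f := fun y => ((bump (x (m k)) y : EReal) - v y).abs / b) hS (fun y hy => by
        rw [ENNReal.le_div_iff_mul_le (Or.inl hb0.ne') (Or.inl hb.ne), htb]
        exact hSv y hy)
    have h2 := h1.trans (varModular_div_le_one_of_varLpNorm_lt (hn k hk))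
    exact absurd ((mul_le_mul_right hcon (t ^ κ)).trans h2) htδ.not_ge
  set B := Metric.ball (x (m n)) (1 / 8)
  have hS₁ : MeasurableSet (B ∩ {y | v y ≤ ((1 / 4 : ℝ) : EReal)}) :=
    measurableSet_ball.inter (measurableSet_le hv measurable_const)
  have hS₂ : MeasurableSet (B ∩ {y | ((1 / 4 : ℝ) : EReal) ≤ v y}) :=
    measurableSet_ball.inter (measurableSet_le measurable_const hv)
  have h1 := key n le_rfl _ hS₁ fun y hy => (quarter_le_abs_sub_or (half_le_bump hy.1) (v y)).1 hy.2
  have h2 := key (n + 1) (Nat.le_succ n) _ hS₂ fun y hy => by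
    have hy1 : dist y (x (m n)) < 1 / 8 := hy.1
    have hd := hx (m n) (m (n + 1)) (hm (Nat.lt_succ_self n)).ne
    have htri := dist_triangle_left (x (m n)) (x (m (n + 1))) y
    rw [bump_eq_zero (x₀ := x (m (n + 1))) (by linarith)]
    exact (quarter_le_abs_sub_or (half_le_bump hy.1) (v y)).2 hy.2
  have hsub : B ⊆ (B ∩ {y | v y ≤ ((1 / 4 : ℝ) : EReal)}) ∪ (B ∩ {y | ((1 / 4 : ℝ) : EReal) ≤ v y}) :=
    fun y hy => (le_total (v y) _).imp (fun h => ⟨hy, h⟩) fun h => ⟨hy, h⟩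
  have := calc δ ≤ μ B := iInf_le _ _
    _ ≤ _ := (measure_mono hsub).trans (measure_union_le _ _)
    _ < δ / 2 + δ / 2 := ENNReal.add_lt_add h1 h2
    _ = δ := ENNReal.add_halves _
  exact this.false

lemma exists_separated_seq_of_measure_eq_top {Y : Type*} [MetricSpace Y] [MeasurableSpace Y]
    {μ : Measure Y} (hμ : μ univ = ⊤)
    (hsup : (⨆ x : Y, μ (Metric.ball x 1)) < ⊤) :
    ∃ x : ℕ → Y, ∀ m n, m ≠ n → 1 ≤ dist (x m) (x n) := by
  refine exists_separated_seq fun t => ?_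
  by_contra hcon
  push Not at hcon
  have hsub : (univ : Set Y) ⊆ ⋃ x ∈ t, Metric.ball x 1 := fun y _ => by
    obtain ⟨x, hx, hxy⟩ := hcon y
    exact mem_biUnion hx (by rwa [Metric.mem_ball, dist_comm])
  have h1 : μ univ < ⊤ := lt_of_le_of_lt ((measure_mono hsub).trans (measure_biUnion_finset_le _ _))
    (ENNReal.sum_lt_top.2 fun x _ => (le_iSup (fun x : Y => μ (Metric.ball x 1)) x).trans_lt hsup)
  exact h1.ne hμ

/-- Both alternatives on `s` and `q` are put in one form, with `ε = 0` allowed exactly when no decay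
in `k` is needed. -/
lemma exists_smoothness_gap {Y : Type*} [MeasurableSpace Y] {μ : Measure Y} {s q : Y → ℝ≥0∞}
    (hs : IsBddVarExponent μ s) (hq : IsVarExponent μ q)
    (h : (essSup s μ < 1 ∧ essInf q μ < ⊤) ∨ (essSup s μ ≤ 1 ∧ essInf q μ = ⊤)) :
    ∃ ε : ℝ, 0 ≤ ε ∧ (∀ᵐ x ∂μ, ε ≤ (s x).toReal ∧ (s x).toReal ≤ 1 - ε) ∧
      ((0 < ε ∧ ∃ r : ℝ, 0 < r ∧ ∀ᵐ x ∂μ, ENNReal.ofReal r ≤ q x) ∨ ∀ᵐ x ∂μ, q x = ⊤) := by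
  rcases h with ⟨hs1, -⟩ | ⟨hs1, hqt⟩
  · obtain ⟨σ, hσ, hsσ⟩ := exists_ofReal_le_ae hs.1.2.2
    set t := (essSup s μ).toReal
    have ht : t < 1 := by
      have := (ENNReal.toReal_lt_toReal hs.2.ne ENNReal.one_ne_top).2 hs1
      simpa using this
    refine ⟨min σ (1 - t), le_min hσ.le (by linarith), ?_,
      Or.inl ⟨lt_min hσ (by linarith), exists_ofReal_le_ae hq.2.2⟩⟩
    filter_upwards [hsσ, ae_le_essSup (f := s) (μ := μ)] with x hx1 hx2
    have hxt : s x ≠ ⊤ := (hx2.trans_lt hs.2).ne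
    have h1 := (ENNReal.ofReal_le_iff_le_toReal hxt).1 hx1
    have h2 : (s x).toReal ≤ t := ENNReal.toReal_mono hs.2.ne hx2
    exact ⟨(min_le_left _ _).trans h1, by linarith [min_le_right σ (1 - t)]⟩
  · refine ⟨0, le_rfl, ?_, Or.inr ?_⟩
    · filter_upwards [ae_le_essSup (f := s) (μ := μ)] with x hx
      refine ⟨ENNReal.toReal_nonneg, ?_⟩
      simpa using ENNReal.toReal_mono ENNReal.one_ne_top (hx.trans hs1)
    · filter_upwards [ae_essInf_le (f := q) (μ := μ)] with x hx
      exact top_le_iff.1 (hqt ▸ hx)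

theorem measure_lt_top_of_compactEmbedding (hsup : (⨆ x : X, μ (Metric.ball x 1)) < ⊤)
    (hinf : 0 < ⨅ x : X, μ (Metric.ball x (1 / 8))) {β : X → ℝ≥0∞} (hp : IsBddVarExponent μ p)
    (hs : IsBddVarExponent μ s) (hβ : IsBddVarExponent μ β) (hq : IsVarExponent μ q)
    (h : (essSup s μ < 1 ∧ essInf q μ < ⊤) ∨ (essSup s μ ≤ 1 ∧ essInf q μ = ⊤))
    (hemb : TLCompactEmbedding μ s p q β ∨ BesovCompactEmbedding μ s p q β) : μ univ < ⊤ := by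
  by_contra hμ
  obtain ⟨x, hx⟩ := exists_separated_seq_of_measure_eq_top (not_lt_top_iff.1 hμ) hsup
  obtain ⟨κ, hκ, hpκ⟩ := exists_ofReal_le_ae hp.1.2.2
  obtain ⟨ε, hε, hsε, hqε⟩ := exists_smoothness_gap hs hq h
  obtain ⟨a, ha0, ha1, ha⟩ := exists_varModular_indicator_ball_le_one hκ hpκ hp.1.2.1 hsup
  obtain ⟨C, hC, hCb⟩ := exists_homNorm_bump_le hε hsε hq.2.1 hqε ha0 ha1 ha
  have hCa : 1 / a + C < ⊤ := ENNReal.add_lt_top.2 ⟨ENNReal.div_lt_top ENNReal.one_ne_top ha0.ne', hC⟩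
  rcases hemb with hemb | hemb
  · exact not_isCompactlyEmbeddedInVarLp hβ.1 hinf (A := HajlaszTL μ s p q) hx
      (fun n => ⟨⟨aeFiniteMeasurable_bump _, (hCb _).1.trans_lt hC⟩, bump_mem_varLp ha0 ha1 (ha _)⟩)
      hCa (fun n => add_le_add (varLpNorm_bump_le ha0 ha1 (ha _)) (hCb _).1) hemb
  · exact not_isCompactlyEmbeddedInVarLp hβ.1 hinf (A := HajlaszBesov μ s p q) hx
      (fun n => ⟨⟨aeFiniteMeasurable_bump _, (hCb _).2.trans_lt hC⟩, bump_mem_varLp ha0 ha1 (ha _)⟩)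
      hCa (fun n => add_le_add (varLpNorm_bump_le ha0 ha1 (ha _)) (hCb _).2) hemb

end

/-! ### The main theorem -/

section

variable {X : Type*} [MeasurableSpace X] (μ : Measure X)

lemma isVarExponent_const {c : ℝ≥0∞} (hc : 0 < c) : IsVarExponent μ fun _ => c :=
  ⟨measurable_const, fun _ => hc,
    hc.trans_le (le_essInf_of_ae_le (f := fun _ => c) c (ae_of_all μ fun _ => le_rfl))⟩

lemma isBddVarExponent_const {c : ℝ≥0∞} (hc : 0 < c) (hc' : c < ⊤) :
    IsBddVarExponent μ fun _ => c :=
  ⟨isVarExponent_const μ hc,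
    (essSup_le_of_ae_le (f := fun _ => c) c (ae_of_all μ fun _ => le_rfl)).trans_lt hc'⟩

end

theorem mainTheorem6 {X : Type*} [MetricSpace X] [MeasurableSpace X] [BorelSpace X]
    (μ : Measure X)
    (hball : ∀ (x : X) (r : ℝ), 0 < r → 0 < μ (Metric.ball x r) ∧ μ (Metric.ball x r) < ⊤)
    (hsup : (⨆ x : X, μ (Metric.ball x 1)) < ⊤)
    (hinf : ∀ r : ℝ, 0 < r → r < 1 → 0 < ⨅ x : X, μ (Metric.ball x r)) :
    List.TFAE [
      μ Set.univ < ⊤,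
      ∀ p s q : X → ℝ≥0∞, IsBddVarExponent μ p → IsBddVarExponent μ s → IsVarExponent μ q →
        TLCompactEmbedding μ s p q p ∧ BesovCompactEmbedding μ s p q p,
      ∃ p s β q : X → ℝ≥0∞, IsBddVarExponent μ p ∧ IsBddVarExponent μ s ∧
        IsBddVarExponent μ β ∧ IsVarExponent μ q ∧
        ((essSup s μ < 1 ∧ essInf q μ < ⊤) ∨ (essSup s μ ≤ 1 ∧ essInf q μ = ⊤)) ∧
        (TLCompactEmbedding μ s p q β ∨ BesovCompactEmbedding μ s p q β)] := by
  tfae_have 1 → 2 := fun hfin p s q hp hs hq =>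
    ⟨tlCompactEmbedding_of_finite hfin hinf hp hs hq,
      besovCompactEmbedding_of_finite hfin hinf hp hs hq⟩
  tfae_have 2 → 3 := by
    intro h
    have h1 := isBddVarExponent_const μ one_pos ENNReal.one_lt_top
    have h2 := isVarExponent_const μ ENNReal.zero_lt_top
    -- All bounded exponents are `1` and `q = ∞`, the endpoint of the second alternative.
    refine ⟨_, _, _, _, h1, h1, h1, h2, Or.inr ⟨?_, ?_⟩, Or.inl (h _ _ _ h1 h1 h2).1⟩
    · exact essSup_le_of_ae_le (f := fun _ => 1) 1 (ae_of_all μ fun _ => le_rfl)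
    · exact top_le_iff.1 (le_essInf_of_ae_le (f := fun _ => ⊤) ⊤ (ae_of_all μ fun _ => le_rfl))
  tfae_have 3 → 1 := by
    rintro ⟨p, s, β, q, hp, hs, hβ, hq, h, hemb⟩
    exact measure_lt_top_of_compactEmbedding hsup (hinf _ (by norm_num) (by norm_num)) hp hs hβ hq
      h hemb
  tfae_finish
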